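/- Let $(\Omega_1,\mathcal A_1)$, $(\Omega_2,\mathcal A_2)$ be measurable spaces, let $\mathcal P$, $\mathcal Q$ be sets of probability measures on $\Omega_1$ and $\Omega_2$, and put $\mathcal P\otimes\mathcal Q=\{P\otimes Q: P\in\mathcal P,\ Q\in\mathcal Q\}$. **Definitions.** For probability measures $P,Q$, a density quotient $\frac{dP}{dQ}$ is a measurable $[0,\infty]$-valued function $L$ with $L<\infty$ $Q$-a.s. and $P(A)=\int_A L\,dQ+P(A\cap\{L=\infty\})$ for all measurable $A$. For a set $\mathcal R$ of probability measures, a curve $(-\varepsilon,\varepsilon)\to\mathcal R$, $t\mapsto R_t$ ($\varepsilon>0$) is $L_2(R_0)$-differentiable with tangent $g\in L_2(R_0)$ if, as $t\to0$, $$\Big\|2\Big(\big(\tfrac{dR_t}{dR_0}\big)^{1/2}-1\Big)-tg\Big\|_{L_2(R_0)}=o(|t|)\quad\text{and}\quad R_t\big(\tfrac{dR_t}{dR_0}=\infty\big)=o(t^2).$$ The tangent space $T(R,\mathcal R)$ is the $L_2(R)$-closure of the linear span of all $g\in L_2(R)$ with $\int g\,dR=0$ that are tangents of such curves with $R_0=R$.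 A functional $k:\mathcal R\to\mathbb R$ is differentiable at $R$ with gradient $\dot k\in L_2(R)$, $\int\dot k\,dR=0$, if $\lim_{t\downarrow0}\frac1t(k(R_t)-k(R_0))=\int\dot k g\,dR$ for every $L_2(R)$-differentiable curve in $\mathcal R$ with $R_0=R$ and tangent $g$. The canonical gradient of $k$ at $R$ is the gradient that lies in $T(R,\mathcal R)$ and has the smallest $L_2(R)$-norm among all gradients. **Setting.** Let $P_0\in\mathcal P$, $Q_0\in\mathcal Q$, and let $k:\mathcal P\otimes\mathcal Q\to\mathbb R$ be differentiable at $P_0\otimes Q_0$ with canonical gradient $\widetilde k$, where $\int\widetilde k^2\,dP_0\otimes Q_0\neq0$. Put $\widetilde k_1(\omega_1)=\int\widetilde k(\omega_1,\omega_2)\,dQ_0(\omega_2)$ and $\widetilde k_2(\omega_2)=\int\widetilde k(\omega_1,\omega_2)\,dP_0(\omega_1)$. Let $\alpha\in(0,1)$, and let $n_1=n_1(n)$, $n_2=n_2(n)$ be sequences of nonnegative integers with $n_1+n_2=n$ for all $n$ and $\lim_{n\to\infty} n_2/n=d\in(0,1)$. Let $\Phi$ be the standard normal distribution function, $u_p=\Phi^{-1}(p)$,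 and $$\sigma_1=\Big(\frac1{1-d}\int\widetilde k_1^2\,dP_0+\frac1d\int\widetilde k_2^2\,dQ_0\Big)^{1/2},\qquad T_n=\frac{\sqrt n}{n_1}\sum_{i=1}^{n_1}\widetilde k_1(\omega_{1,i})+\frac{\sqrt n}{n_2}\sum_{j=1}^{n_2}\widetilde k_2(\omega_{2,j}).$$ Let $\psi_n$ be the two-sided test with $\psi_n=1$ if $|T_n|>c$ and $\psi_n=0$ if $|T_n|\le c$, where $c=u_{1-\alpha/2}\,\sigma_1$. Let $\mathcal F_2$ be the set of all sequences $(P_{t_n}\otimes Q_{t_n})_n$ such that $t_n\to0$, the limit $\lim_{n\to\infty} t_n\sqrt n$ exists in $\mathbb R$ and is positive, and, for some $\varepsilon>0$ with $|t_n|<\varepsilon$ for all $n$, $t\mapsto P_t\otimes Q_t$ is an $L_2(P_0\otimes Q_0)$-differentiable curve $(-\varepsilon,\varepsilon)\to\mathcal P\otimes\mathcal Q$ with value $P_0\otimes Q_0$ at $t=0$. **Statement.** 1. For every sequence $(P_{t_n}\otimes Q_{t_n})_n\in\mathcal F_2$ the limit $\vartheta:=\lim_{n\to\infty}\sqrt n\,\big(k(P_{t_n}\otimes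 Q_{t_n})-k(P_0\otimes Q_0)\big)$ exists in $\mathbb R$, and $$\lim_{n\to\infty}\int\psi_n\,dP_{t_n}^{n_1}\otimes Q_{t_n}^{n_2}=\Phi\Big(\frac{\vartheta}{\sigma_1}-u_{1-\alpha/2}\Big)+\Phi\Big(-\frac{\vartheta}{\sigma_1}-u_{1-\alpha/2}\Big).$$ 2. Let $\mathcal H_2$ and $\mathcal K_2$ be the sets of those sequences in $\mathcal F_2$ for which $\vartheta=0$ and $\vartheta\ne0$, respectively. Then $(\psi_n)_n$ is asymptotically unbiased at level $\alpha$ for $\mathcal H_2$ against $\mathcal K_2$: $\limsup_{n\to\infty}\int\psi_n\,dP_{t_n}^{n_1}\otimes Q_{t_n}^{n_2}\le\alpha$ for every sequence in $\mathcal H_2$, and $\liminf_{n\to\infty}\int\psi_n\,dP_{t_n}^{n_1}\otimes Q_{t_n}^{n_2}\ge\alpha$ for every sequence in $\mathcal K_2$. -/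

import Mathlib

open MeasureTheory ProbabilityTheory Filter Topology Asymptotics
open scoped ENNReal

namespace TwoSample

noncomputable section

/-- `L` is a density quotient (a version of the generalized density `dP/dQ`) of `P` with respect
to `Q`: a measurable `[0, ∞]`-valued function, finite `Q`-almost surely, with
`P A = ∫_A L dQ + P (A ∩ {L = ∞})` for every measurable set `A`. -/
structure IsDensityQuotient {Ω : Type*} [MeasurableSpace Ω] (P Q : ProbabilityMeasure Ω)
    (L : Ω → ℝ≥0∞) : Prop where
  measurable : Measurable L
  apply_eq : ∀ A : Set Ω, MeasurableSet A →
    (P : Measure Ω) A = ∫⁻ ω in A, L ω ∂(Q : Measure Ω) + (P : Measure Ω) (A ∩ {ω | L ω = ∞})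
  finite_ae : ∀ᵐ ω ∂(Q : Measure Ω), L ω < ∞

/-- `t ↦ P t`, `|t| < ε`, is an `L₂(P 0)`-differentiable curve in the family `Pfam` with tangent `g`:
`‖2 ((dP_t/dP_0)^{1/2} - 1) - t g‖_{L₂(P_0)} = o(|t|)` and `P_t (dP_t/dP_0 = ∞) = o(t²)`
as `t → 0`. (Only the values `P t` with `|t| < ε` matter; density quotients are unique up to
`(P_t + P_0)`-null sets, so the choice of versions is irrelevant.) -/
structure IsL2DiffCurve {Ω : Type*} [MeasurableSpace Ω] (Pfam : Set (ProbabilityMeasure Ω))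
    (ε : ℝ) (P : ℝ → ProbabilityMeasure Ω) (g : Ω → ℝ) : Prop where
  pos : 0 < ε
  mem : ∀ t, |t| < ε → P t ∈ Pfam
  memLp : MemLp g 2 (P 0 : Measure Ω)
  differentiable : ∃ L : ℝ → Ω → ℝ≥0∞,
    (∀ t, IsDensityQuotient (P t) (P 0) (L t)) ∧
    (fun t : ℝ => (eLpNorm (fun ω => 2 * (√(L t ω).toReal - 1) - t * g ω) 2
      (P 0 : Measure Ω)).toReal) =o[𝓝[≠] 0] (fun t : ℝ => |t|) ∧
    (fun t : ℝ => (P t : Measure Ω).real {ω | L t ω = ∞}) =o[𝓝[≠] 0] (fun t : ℝ => t ^ 2)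

/-- The tangent cone `K(P, Pfam)`: all `g ∈ L₂(P)` with `∫ g dP = 0` that are tangents of
`L₂`-differentiable curves in `Pfam` through `P`. -/
def tangentCone {Ω : Type*} [MeasurableSpace Ω] (Pfam : Set (ProbabilityMeasure Ω))
    (P : ProbabilityMeasure Ω) : Set (Lp ℝ 2 (P : Measure Ω)) :=
  {g | ∫ ω, g ω ∂(P : Measure Ω) = 0 ∧
    ∃ (ε : ℝ) (c : ℝ → ProbabilityMeasure Ω), c 0 = P ∧ IsL2DiffCurve Pfam ε c g}

/-- The tangent space `T(P, Pfam)`: the closed linear span of the tangent cone in `L₂(P)`. -/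
def tangentSpace {Ω : Type*} [MeasurableSpace Ω] (Pfam : Set (ProbabilityMeasure Ω))
    (P : ProbabilityMeasure Ω) : Submodule ℝ (Lp ℝ 2 (P : Measure Ω)) :=
  (Submodule.span ℝ (tangentCone Pfam P)).topologicalClosure

/-- The statistical functional `k` on `Pfam` is differentiable at `P` with gradient `κ`, where
`κ ∈ L₂(P)` and `∫ κ dP = 0`. (Only the values of `k` on `Pfam` matter.) -/
structure IsGradient {Ω : Type*} [MeasurableSpace Ω] (Pfam : Set (ProbabilityMeasure Ω))
    (k : ProbabilityMeasure Ω → ℝ) (P : ProbabilityMeasure Ω) (κ : Ω → ℝ) : Prop where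
  memLp : MemLp κ 2 (P : Measure Ω)
  integral_eq_zero : ∫ ω, κ ω ∂(P : Measure Ω) = 0
  tendsto : ∀ (ε : ℝ) (c : ℝ → ProbabilityMeasure Ω) (g : Ω → ℝ),
    IsL2DiffCurve Pfam ε c g → c 0 = P →
      Tendsto (fun t : ℝ => (1 / t) * (k (c t) - k (c 0))) (𝓝[>] 0)
        (𝓝 (∫ ω, κ ω * g ω ∂(P : Measure Ω)))

/-- `κ` is (a version of) the canonical gradient of `k` at `P`: the gradient that lies in the
tangent space and has the smallest norm among all gradients. -/
structure IsCanonicalGradient {Ω : Type*} [MeasurableSpace Ω] (Pfam : Set (ProbabilityMeasure Ω))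
    (k : ProbabilityMeasure Ω → ℝ) (P : ProbabilityMeasure Ω) (κ : Ω → ℝ) : Prop where
  isGradient : IsGradient Pfam k P κ
  mem_tangentSpace : isGradient.memLp.toLp κ ∈ tangentSpace Pfam P
  norm_le : ∀ κ' : Ω → ℝ, IsGradient Pfam k P κ' →
    eLpNorm κ 2 (P : Measure Ω) ≤ eLpNorm κ' 2 (P : Measure Ω)

section TwoSampleProblem

variable {Ω₁ Ω₂ : Type*} [MeasurableSpace Ω₁] [MeasurableSpace Ω₂]

/-- The family `Pfam ⊗ Qfam` of all products of members of `Pfam` and `Qfam`. -/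
def prodFamily (Pfam : Set (ProbabilityMeasure Ω₁)) (Qfam : Set (ProbabilityMeasure Ω₂)) :
    Set (ProbabilityMeasure (Ω₁ × Ω₂)) :=
  {R | ∃ P ∈ Pfam, ∃ Q ∈ Qfam, R = P.prod Q}

/-- The set `𝓕₂` of all sequences `(P_{t_n} ⊗ Q_{t_n})`, given by their pairs of factors, where
`t_n → 0`, `lim t_n √n` exists and is positive, and `t ↦ P_t ⊗ Q_t`, `|t| < ε`, is an
`L₂(P₀ ⊗ Q₀)`-differentiable curve in `Pfam ⊗ Qfam`. -/
def localSequences (Pfam : Set (ProbabilityMeasure Ω₁)) (Qfam : Set (ProbabilityMeasure Ω₂))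
    (P₀ : ProbabilityMeasure Ω₁) (Q₀ : ProbabilityMeasure Ω₂) :
    Set (ℕ → ProbabilityMeasure Ω₁ × ProbabilityMeasure Ω₂) :=
  {S | ∃ (t : ℕ → ℝ) (τ ε : ℝ) (P : ℝ → ProbabilityMeasure Ω₁) (Q : ℝ → ProbabilityMeasure Ω₂)
      (g : Ω₁ × Ω₂ → ℝ),
    Tendsto t atTop (𝓝 0) ∧ Tendsto (fun n => t n * √(n : ℝ)) atTop (𝓝 τ) ∧ 0 < τ ∧
    P 0 = P₀ ∧ Q 0 = Q₀ ∧
    IsL2DiffCurve (prodFamily Pfam Qfam) ε (fun s => (P s).prod (Q s)) g ∧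
    ∀ n, |t n| < ε ∧ S n = (P (t n), Q (t n))}

/-- `√n (k(P_{t_n} ⊗ Q_{t_n}) - k(P₀ ⊗ Q₀))`. -/
def localValue (k : ProbabilityMeasure (Ω₁ × Ω₂) → ℝ)
    (P₀ : ProbabilityMeasure Ω₁) (Q₀ : ProbabilityMeasure Ω₂)
    (S : ℕ → ProbabilityMeasure Ω₁ × ProbabilityMeasure Ω₂) (n : ℕ) : ℝ :=
  √(n : ℝ) * (k ((S n).1.prod (S n).2) - k (P₀.prod Q₀))

/-- The set `𝓗₂` of implicit hypotheses. -/
def implicitHypotheses (Pfam : Set (ProbabilityMeasure Ω₁)) (Qfam : Set (ProbabilityMeasure Ω₂))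
    (k : ProbabilityMeasure (Ω₁ × Ω₂) → ℝ)
    (P₀ : ProbabilityMeasure Ω₁) (Q₀ : ProbabilityMeasure Ω₂) :
    Set (ℕ → ProbabilityMeasure Ω₁ × ProbabilityMeasure Ω₂) :=
  {S | S ∈ localSequences Pfam Qfam P₀ Q₀ ∧ Tendsto (localValue k P₀ Q₀ S) atTop (𝓝 0)}

/-- The set `𝓚₂` of implicit alternatives. -/
def implicitAlternatives (Pfam : Set (ProbabilityMeasure Ω₁)) (Qfam : Set (ProbabilityMeasure Ω₂))
    (k : ProbabilityMeasure (Ω₁ × Ω₂) → ℝ)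
    (P₀ : ProbabilityMeasure Ω₁) (Q₀ : ProbabilityMeasure Ω₂) :
    Set (ℕ → ProbabilityMeasure Ω₁ × ProbabilityMeasure Ω₂) :=
  {S | S ∈ localSequences Pfam Qfam P₀ Q₀ ∧
    ∃ ϑ : ℝ, ϑ ≠ 0 ∧ Tendsto (localValue k P₀ Q₀ S) atTop (𝓝 ϑ)}

/-- `κ₁(ω₁) = ∫ κ(ω₁, ω₂) dQ₀(ω₂)`. -/
def component₁ (Q₀ : ProbabilityMeasure Ω₂) (κ : Ω₁ × Ω₂ → ℝ) (ω₁ : Ω₁) : ℝ :=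
  ∫ ω₂, κ (ω₁, ω₂) ∂(Q₀ : Measure Ω₂)

/-- `κ₂(ω₂) = ∫ κ(ω₁, ω₂) dP₀(ω₁)`. -/
def component₂ (P₀ : ProbabilityMeasure Ω₁) (κ : Ω₁ × Ω₂ → ℝ) (ω₂ : Ω₂) : ℝ :=
  ∫ ω₁, κ (ω₁, ω₂) ∂(P₀ : Measure Ω₁)

/-- `σ₁ = ((1 - d)⁻¹ ∫ κ₁² dP₀ + d⁻¹ ∫ κ₂² dQ₀)^{1/2}`. -/
def sigma₁ (P₀ : ProbabilityMeasure Ω₁) (Q₀ : ProbabilityMeasure Ω₂) (κ : Ω₁ × Ω₂ → ℝ)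
    (d : ℝ) : ℝ :=
  √(1 / (1 - d) * ∫ ω₁, component₁ Q₀ κ ω₁ ^ 2 ∂(P₀ : Measure Ω₁) +
    1 / d * ∫ ω₂, component₂ P₀ κ ω₂ ^ 2 ∂(Q₀ : Measure Ω₂))

/-- The statistic `T_n` for samples of sizes `m₁` and `m₂`, with `n = m₁ + m₂`. -/
def testStatistic (P₀ : ProbabilityMeasure Ω₁) (Q₀ : ProbabilityMeasure Ω₂) (κ : Ω₁ × Ω₂ → ℝ)
    (m₁ m₂ : ℕ) (ω : (Fin m₁ → Ω₁) × (Fin m₂ → Ω₂)) : ℝ :=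
  √((m₁ + m₂ : ℕ) : ℝ) / m₁ * ∑ i, component₁ Q₀ κ (ω.1 i) +
    √((m₁ + m₂ : ℕ) : ℝ) / m₂ * ∑ j, component₂ P₀ κ (ω.2 j)

/-- The distribution function `Φ` of the standard normal distribution. -/
def stdNormalCDF (x : ℝ) : ℝ := cdf (gaussianReal 0 1) x

/-- The `p`-quantile `u_p = Φ⁻¹(p)` of the standard normal distribution, `0 < p < 1`. -/
def stdNormalQuantile (p : ℝ) : ℝ := sInf {x : ℝ | p ≤ stdNormalCDF x}

/-- The two-sided test that rejects (value `1`) if `|T_n| > c` and accepts (value `0`) if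
`|T_n| ≤ c`, where `c = u_{1 - α/2} σ₁`. -/
def twoSidedTest (P₀ : ProbabilityMeasure Ω₁) (Q₀ : ProbabilityMeasure Ω₂) (κ : Ω₁ × Ω₂ → ℝ)
    (d α : ℝ) (m₁ m₂ : ℕ) : (Fin m₁ → Ω₁) × (Fin m₂ → Ω₂) → ℝ :=
  Set.indicator
    {ω | stdNormalQuantile (1 - α / 2) * sigma₁ P₀ Q₀ κ d < |testStatistic P₀ Q₀ κ m₁ m₂ ω|} 1

/-- The law `P^{m₁} ⊗ Q^{m₂}` of two independent i.i.d. samples. -/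
def sampleLaw (P : ProbabilityMeasure Ω₁) (Q : ProbabilityMeasure Ω₂) (m₁ m₂ : ℕ) :
    Measure ((Fin m₁ → Ω₁) × (Fin m₂ → Ω₂)) :=
  (Measure.pi fun _ : Fin m₁ => (P : Measure Ω₁)).prod
    (Measure.pi fun _ : Fin m₂ => (Q : Measure Ω₂))

/-- The power `∫ φ_n d(P_{t_n}^{n₁} ⊗ Q_{t_n}^{n₂})` of a sequence of tests. -/
def power (n₁ n₂ : ℕ → ℕ) (φ : ∀ n, (Fin (n₁ n) → Ω₁) × (Fin (n₂ n) → Ω₂) → ℝ)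
    (S : ℕ → ProbabilityMeasure Ω₁ × ProbabilityMeasure Ω₂) (n : ℕ) : ℝ :=
  ∫ ω, φ n ω ∂(sampleLaw (S n).1 (S n).2 (n₁ n) (n₂ n))

/-- A sequence of tests is asymptotically unbiased at level `α` for the hypotheses `H` against
the alternatives `K`. -/
def IsAsymptoticallyUnbiased (α : ℝ) (n₁ n₂ : ℕ → ℕ)
    (φ : ∀ n, (Fin (n₁ n) → Ω₁) × (Fin (n₂ n) → Ω₂) → ℝ)
    (H K : Set (ℕ → ProbabilityMeasure Ω₁ × ProbabilityMeasure Ω₂)) : Prop :=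
  (∀ S ∈ H, limsup (power n₁ n₂ φ S) atTop ≤ α) ∧
    ∀ S ∈ K, α ≤ liminf (power n₁ n₂ φ S) atTop

end TwoSampleProblem

end

end TwoSample

open TwoSample

/-! The test statistic is asymptotically normal with variance `σ₁ ^ 2` under every local sequence,
and only its mean `ϑ` depends on the sequence; the power therefore converges to that of the
two-sided Gauss test with mean `ϑ`.

The product structure enters through tangents. If `t ↦ P t ⊗ Q t` is `L₂`-differentiable with
tangent `g`, both factors are differentiable, their tangents are the partial integrals `g₁`, `g₂` of
`g`, and `g = g₁ + g₂` almost surely (`HasL2Tangent.fst`, `HasL2Tangent.snd`,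
`HasL2Tangent.ae_eq_add`). Hence `∫ κ g = ∫ κ₁ g₁ + ∫ κ₂ g₂`. With `τ = lim t_n √n`, the number `ϑ =
τ ∫ κ g` is at once the limit of the rescaled increments of `k` and the asymptotic mean of the
statistic.

Normality under the moving laws is proved directly with characteristic functions, without
contiguity. For centred `f` and `a_n √n → A`, `HasL2Tangent.tendsto_nat_mul_integral_exp_sub_one`
gives `n (E exp(i a_n f) - 1) → i A τ ∫ f g - A² ∫ f² / 2`, the expectation being taken under `P (t
n)`. Taking powers and multiplying the two samples yields a Gaussian characteristic function
(`tendsto_charFun_sampleLaw`), and Lévy's continuity theorem gives the power.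

The limit is nondegenerate (`sigma₁_pos`): if both components of `κ` vanished, `κ` would be
orthogonal to all tangents `g₁ + g₂`, hence to the tangent space that contains it. Unbiasedness
holds because `a ↦ Φ(a - u) + Φ(-a - u)` is minimal at `0` (`two_mul_stdNormalCDF_neg_le`), where
for `u = u_{1 - α/2}` it equals `α`. -/

namespace TwoSample

/-! ### Square roots of densities and density quotients. -/

variable {Ω Ω₁ Ω₂ : Type*} [MeasurableSpace Ω] [MeasurableSpace Ω₁] [MeasurableSpace Ω₂]

/-- The square root of the density of the absolutely continuous part of `P` with respect
to `Q`. -/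
noncomputable def sqrtDensity (P Q : Measure Ω) (ω : Ω) : ℝ := √((P.rnDeriv Q ω).toReal)

lemma measurable_sqrtDensity (P Q : Measure Ω) : Measurable (sqrtDensity P Q) :=
  (Measure.measurable_rnDeriv P Q).ennreal_toReal.sqrt

lemma sqrtDensity_nonneg (P Q : Measure Ω) (ω : Ω) : 0 ≤ sqrtDensity P Q ω := Real.sqrt_nonneg _

lemma sqrtDensity_sq (P Q : Measure Ω) (ω : Ω) :
    sqrtDensity P Q ω ^ 2 = (P.rnDeriv Q ω).toReal := Real.sq_sqrt ENNReal.toReal_nonneg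

lemma memLp_sqrtDensity (P Q : Measure Ω) [IsFiniteMeasure P] : MemLp (sqrtDensity P Q) 2 Q := by
  rw [memLp_two_iff_integrable_sq (measurable_sqrtDensity P Q).aestronglyMeasurable]
  simpa only [sqrtDensity_sq] using Measure.integrable_toReal_rnDeriv

lemma integral_sqrtDensity_sq_le_one (P Q : Measure Ω) [IsProbabilityMeasure P] [SigmaFinite Q] :
    ∫ ω, sqrtDensity P Q ω ^ 2 ∂Q ≤ 1 := by
  simp only [sqrtDensity_sq]
  calc ∫ ω, (P.rnDeriv Q ω).toReal ∂Q ≤ P.real Set.univ := by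
        rw [integral_toReal (Measure.measurable_rnDeriv _ _).aemeasurable (Measure.rnDeriv_lt_top _ _)]
        exact ENNReal.toReal_mono (measure_ne_top _ _) Measure.lintegral_rnDeriv_le
    _ = 1 := by simp

namespace IsDensityQuotient

variable {P Q : ProbabilityMeasure Ω} {L : Ω → ℝ≥0∞}

lemma eq_add (h : IsDensityQuotient P Q L) :
    (P : Measure Ω) = (P : Measure Ω).restrict {ω | L ω = ∞} +
      (Q : Measure Ω).withDensity L := by
  ext A hA
  rw [Measure.add_apply, Measure.restrict_apply hA, withDensity_apply _ hA, add_comm]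
  exact h.apply_eq A hA

lemma measurableSet_eq_top (h : IsDensityQuotient P Q L) : MeasurableSet {ω | L ω = ∞} :=
  h.measurable (measurableSet_singleton ∞)

/-- The set where `L = ∞` is `Q`-null and carries the rest of `P`, so `L` yields a Lebesgue
decomposition, which is unique. Differentiability thus does not depend on the versions chosen. -/
lemma ae_eq_rnDeriv (h : IsDensityQuotient P Q L) :
    L =ᵐ[(Q : Measure Ω)] (P : Measure Ω).rnDeriv Q := by
  refine Measure.eq_rnDeriv h.measurable ?_ h.eq_add
  refine ⟨{ω | L ω = ∞}ᶜ, h.measurableSet_eq_top.compl, ?_, ?_⟩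
  · rw [Measure.restrict_apply h.measurableSet_eq_top.compl]; simp
  · rw [compl_compl]
    have := h.finite_ae
    rw [ae_iff] at this
    simpa using this

lemma sqrt_ae_eq (h : IsDensityQuotient P Q L) :
    (fun ω => √(L ω).toReal) =ᵐ[(Q : Measure Ω)] sqrtDensity P Q := by
  filter_upwards [h.ae_eq_rnDeriv] with ω hω
  simp [sqrtDensity, hω]

lemma measureReal_eq_top (h : IsDensityQuotient P Q L) :
    (P : Measure Ω).real {ω | L ω = ∞} = 1 - ∫ ω, sqrtDensity P Q ω ^ 2 ∂(Q : Measure Ω) := by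
  have h1 := congrArg ENNReal.toReal (h.apply_eq Set.univ MeasurableSet.univ)
  have h2 : ∫⁻ ω, L ω ∂(Q : Measure Ω) ≠ ∞ := by
    have := h.apply_eq Set.univ MeasurableSet.univ
    intro h3
    simp [h3] at this
  rw [ENNReal.toReal_add (by simpa using h2) (measure_ne_top _ _)] at h1
  have h3 : ∫ ω, sqrtDensity P Q ω ^ 2 ∂(Q : Measure Ω) =
      (∫⁻ ω, L ω ∂(Q : Measure Ω)).toReal := by
    rw [← integral_toReal h.measurable.aemeasurable h.finite_ae]
    refine integral_congr_ae ?_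
    filter_upwards [h.ae_eq_rnDeriv] with ω hω
    simp [sqrtDensity_sq, hω]
  rw [h3, Measure.real]
  simp only [measure_univ, Measure.restrict_univ, Set.univ_inter, ENNReal.toReal_one] at h1
  linarith

end IsDensityQuotient

/-! ### `L₂` tangents and densities of product measures. -/

/-- `L₂`-differentiability of `t ↦ P t` at `0` with tangent `g`, in terms of the square roots of
the Radon-Nikodym derivatives. -/
structure HasL2Tangent (P : ℝ → ProbabilityMeasure Ω) (g : Ω → ℝ) : Prop where
  memLp : MemLp g 2 (P 0 : Measure Ω)
  remainder : (fun t : ℝ => ∫ ω, (2 * (sqrtDensity (P t : Measure Ω) (P 0) ω - 1) - t * g ω) ^ 2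
    ∂(P 0 : Measure Ω)) =o[𝓝[≠] 0] (fun t : ℝ => t ^ 2)
  singular : (fun t : ℝ => 1 - ∫ ω, sqrtDensity (P t : Measure Ω) (P 0) ω ^ 2
    ∂(P 0 : Measure Ω)) =o[𝓝[≠] 0] (fun t : ℝ => t ^ 2)

lemma integral_sq_eq_toReal_eLpNorm_sq {μ : Measure Ω} {f : Ω → ℝ} (hf : MemLp f 2 μ) :
    ∫ ω, f ω ^ 2 ∂μ = (eLpNorm f 2 μ).toReal ^ 2 := by
  rw [hf.eLpNorm_eq_integral_rpow_norm (by simp) (by simp), ENNReal.toReal_ofReal (by positivity),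
    ← Real.rpow_natCast, ← Real.rpow_mul (integral_nonneg fun _ => by positivity)]
  simp

lemma memLp_remainder {P₀ P : ProbabilityMeasure Ω} {g : Ω → ℝ}
    (hg : MemLp g 2 (P₀ : Measure Ω)) (t : ℝ) :
    MemLp (fun ω => 2 * (sqrtDensity (P : Measure Ω) P₀ ω - 1) - t * g ω) 2
      (P₀ : Measure Ω) :=
  (((memLp_sqrtDensity _ _).sub (memLp_const 1)).const_mul 2).sub (hg.const_mul t)

lemma IsL2DiffCurve.hasL2Tangent {Pfam : Set (ProbabilityMeasure Ω)} {ε : ℝ}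
    {P : ℝ → ProbabilityMeasure Ω} {g : Ω → ℝ} (h : IsL2DiffCurve Pfam ε P g) :
    HasL2Tangent P g := by
  obtain ⟨L, hL, h1, h2⟩ := h.differentiable
  refine ⟨h.memLp, ?_, ?_⟩
  · have h3 := h1.pow (n := 2) (by norm_num)
    simp only [sq_abs] at h3
    refine h3.congr_left fun t => ?_
    rw [integral_sq_eq_toReal_eLpNorm_sq (memLp_remainder h.memLp t)]
    congr 2
    refine eLpNorm_congr_ae ?_
    filter_upwards [(hL t).sqrt_ae_eq] with ω hω
    rw [hω]
  · exact h2.congr_left fun t => (hL t).measureReal_eq_top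

/-- Splitting each factor into singular and absolutely continuous parts, every term of the product
that contains a singular factor is singular to `P₀ ⊗ Q₀`; what remains has the product density. -/
lemma rnDeriv_prod_ae_eq (P P₀ : Measure Ω₁) (Q Q₀ : Measure Ω₂) [IsFiniteMeasure P]
    [IsFiniteMeasure P₀] [IsFiniteMeasure Q] [IsFiniteMeasure Q₀] :
    (fun z => P.rnDeriv P₀ z.1 * Q.rnDeriv Q₀ z.2) =ᵐ[P₀.prod Q₀]
      (P.prod Q).rnDeriv (P₀.prod Q₀) := by
  have hm : Measurable fun z : Ω₁ × Ω₂ => P.rnDeriv P₀ z.1 * Q.rnDeriv Q₀ z.2 := by fun_prop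
  refine Measure.eq_rnDeriv (s := (P.singularPart P₀).prod Q +
    (P₀.withDensity (P.rnDeriv P₀)).prod (Q.singularPart Q₀)) hm ?_ ?_
  · refine Measure.MutuallySingular.add_left_iff.2 ⟨?_, ?_⟩
    · obtain ⟨A, hA, h1, h2⟩ := Measure.mutuallySingular_singularPart P P₀
      refine ⟨A ×ˢ Set.univ, hA.prod .univ, by simp [h1], ?_⟩
      rw [show (A ×ˢ (Set.univ : Set Ω₂))ᶜ = Aᶜ ×ˢ Set.univ by ext; simp]
      simp [h2]
    · obtain ⟨A, hA, h1, h2⟩ := Measure.mutuallySingular_singularPart Q Q₀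
      refine ⟨Set.univ ×ˢ A, MeasurableSet.univ.prod hA, by simp [h1], ?_⟩
      rw [show ((Set.univ : Set Ω₁) ×ˢ A)ᶜ = Set.univ ×ˢ Aᶜ by ext; simp]
      simp [h2]
  · rw [← prod_withDensity (by fun_prop) (by fun_prop), add_assoc, ← Measure.prod_add,
      ← Measure.haveLebesgueDecomposition_add Q Q₀, ← Measure.add_prod,
      ← Measure.haveLebesgueDecomposition_add P P₀]

lemma sqrtDensity_prod_ae_eq (P P₀ : Measure Ω₁) (Q Q₀ : Measure Ω₂) [IsFiniteMeasure P]
    [IsFiniteMeasure P₀] [IsFiniteMeasure Q] [IsFiniteMeasure Q₀] :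
    sqrtDensity (P.prod Q) (P₀.prod Q₀) =ᵐ[P₀.prod Q₀]
      fun z => sqrtDensity P P₀ z.1 * sqrtDensity Q Q₀ z.2 := by
  filter_upwards [rnDeriv_prod_ae_eq P P₀ Q Q₀] with z hz
  rw [sqrtDensity, ← hz, ENNReal.toReal_mul, Real.sqrt_mul ENNReal.toReal_nonneg]
  rfl

lemma sq_integral_le_integral_sq {μ : Measure Ω} [IsProbabilityMeasure μ] {f : Ω → ℝ}
    (hf : Integrable (fun ω => f ω ^ 2) μ) : (∫ ω, f ω ∂μ) ^ 2 ≤ ∫ ω, f ω ^ 2 ∂μ := by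
  by_cases h : Integrable f μ
  · have h1 : 0 ≤ ∫ ω, (f ω - ∫ ω', f ω' ∂μ) ^ 2 ∂μ := integral_nonneg fun _ => sq_nonneg _
    set c := ∫ ω', f ω' ∂μ with hc
    have h2 : ∫ ω, (f ω - c) ^ 2 ∂μ = ∫ ω, f ω ^ 2 ∂μ - 2 * c * c + c ^ 2 := by
      have : (fun ω => (f ω - c) ^ 2) = fun ω => (f ω ^ 2 - 2 * c * f ω) + c ^ 2 := by
        ext; ring
      have h3 : Integrable (fun ω => f ω ^ 2 - 2 * c * f ω) μ := hf.sub (h.const_mul _)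
      rw [this, integral_add h3 (integrable_const _),
        integral_sub hf (h.const_mul _), integral_const_mul, ← hc]
      simp
    nlinarith
  -- Without integrability the integral on the left is `0` by convention.
  · rw [integral_undef h]
    simpa using integral_nonneg fun ω => sq_nonneg (f ω)

lemma memLp_fst {μ : Measure Ω₁} {ν : Measure Ω₂} [IsProbabilityMeasure ν] {u : Ω₁ → ℝ}
    (hu : MemLp u 2 μ) : MemLp (fun z : Ω₁ × Ω₂ => u z.1) 2 (μ.prod ν) :=
  hu.comp_measurePreserving measurePreserving_fst

lemma memLp_snd {μ : Measure Ω₁} {ν : Measure Ω₂} [IsProbabilityMeasure μ] [SFinite ν]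
    {v : Ω₂ → ℝ} (hv : MemLp v 2 ν) : MemLp (fun z : Ω₁ × Ω₂ => v z.2) 2 (μ.prod ν) :=
  hv.comp_measurePreserving measurePreserving_snd

/-! ### `L₂` bounds for partial integrals. -/

section Marginal

variable {μ : Measure Ω₁} {ν : Measure Ω₂} [IsProbabilityMeasure μ] [IsProbabilityMeasure ν]
  {f : Ω₁ × Ω₂ → ℝ}

lemma ae_sq_integral_le (hf : MemLp f 2 (μ.prod ν)) :
    ∀ᵐ x ∂μ, (∫ y, f (x, y) ∂ν) ^ 2 ≤ ∫ y, f (x, y) ^ 2 ∂ν := by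
  filter_upwards [hf.integrable_sq.prod_right_ae] with x hx
  exact sq_integral_le_integral_sq hx

lemma memLp_integral_right (hf : MemLp f 2 (μ.prod ν)) :
    MemLp (fun x => ∫ y, f (x, y) ∂ν) 2 μ := by
  have hm : AEStronglyMeasurable (fun x => ∫ y, f (x, y) ∂ν) μ :=
    hf.aestronglyMeasurable.integral_prod_right'
  rw [memLp_two_iff_integrable_sq hm]
  refine hf.integrable_sq.integral_prod_left.mono' (hm.pow 2) ?_
  filter_upwards [ae_sq_integral_le hf] with x hx
  rwa [Real.norm_of_nonneg (sq_nonneg _)]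

lemma integral_sq_integral_right_le (hf : MemLp f 2 (μ.prod ν)) :
    ∫ x, (∫ y, f (x, y) ∂ν) ^ 2 ∂μ ≤ ∫ z, f z ^ 2 ∂μ.prod ν := by
  rw [integral_prod _ hf.integrable_sq]
  exact integral_mono_ae (memLp_integral_right hf).integrable_sq
    hf.integrable_sq.integral_prod_left (ae_sq_integral_le hf)

lemma MemLp.swap_prod (hf : MemLp f 2 (μ.prod ν)) :
    MemLp (fun z : Ω₂ × Ω₁ => f z.swap) 2 (ν.prod μ) :=
  hf.comp_measurePreserving Measure.measurePreserving_swap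

lemma memLp_integral_left (hf : MemLp f 2 (μ.prod ν)) :
    MemLp (fun y => ∫ x, f (x, y) ∂μ) 2 ν :=
  memLp_integral_right (MemLp.swap_prod hf)

lemma memLp_mul_prod {u : Ω₁ → ℝ} {v : Ω₂ → ℝ} (hu : MemLp u 2 μ) (hv : MemLp v 2 ν) :
    MemLp (fun z : Ω₁ × Ω₂ => u z.1 * v z.2) 2 (μ.prod ν) := by
  have hm : AEStronglyMeasurable (fun z : Ω₁ × Ω₂ => u z.1 * v z.2) (μ.prod ν) :=
    (memLp_fst hu).aestronglyMeasurable.mul (memLp_snd hv).aestronglyMeasurable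
  rw [memLp_two_iff_integrable_sq hm]
  simp only [mul_pow]
  exact hu.integrable_sq.mul_prod hv.integrable_sq

lemma integral_sq_mul_prod (u : Ω₁ → ℝ) (v : Ω₂ → ℝ) :
    ∫ z : Ω₁ × Ω₂, (u z.1 * v z.2) ^ 2 ∂μ.prod ν = (∫ x, u x ^ 2 ∂μ) * ∫ y, v y ^ 2 ∂ν := by
  simp only [mul_pow]
  exact integral_prod_mul (fun x => u x ^ 2) (fun y => v y ^ 2)

lemma integral_add_sq_le {μ : Measure Ω} {u v : Ω → ℝ} (hu : MemLp u 2 μ) (hv : MemLp v 2 μ) :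
    ∫ ω, (u ω + v ω) ^ 2 ∂μ ≤ 2 * ∫ ω, u ω ^ 2 ∂μ + 2 * ∫ ω, v ω ^ 2 ∂μ := by
  rw [← integral_const_mul, ← integral_const_mul, ← integral_add (hu.integrable_sq.const_mul 2)
    (hv.integrable_sq.const_mul 2)]
  refine integral_mono (hu.add hv).integrable_sq
    ((hu.integrable_sq.const_mul 2).add (hv.integrable_sq.const_mul 2)) fun ω => ?_
  dsimp only
  nlinarith [sq_nonneg (u ω - v ω)]

/-- The remainder of a first marginal is controlled by the remainder of the product. -/
lemma integral_marginal_remainder_le {s : Ω₁ → ℝ} {r : Ω₂ → ℝ} (hs : MemLp s 2 μ)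
    (hr : MemLp r 2 ν) (hf : MemLp f 2 (μ.prod ν)) (t : ℝ) :
    ∫ x, (2 * (s x - 1) - t * ∫ y, f (x, y) ∂ν) ^ 2 ∂μ ≤
      2 * ∫ z, (2 * (s z.1 * r z.2 - 1) - t * f z) ^ 2 ∂μ.prod ν +
        8 * (∫ x, s x ^ 2 ∂μ) * (1 - ∫ y, r y ∂ν) ^ 2 := by
  set b := ∫ y, r y ∂ν with hb
  have hF : MemLp (fun z : Ω₁ × Ω₂ => 2 * (s z.1 * r z.2 - 1) - t * f z) 2 (μ.prod ν) :=
    (((memLp_mul_prod hs hr).sub (memLp_const 1)).const_mul 2).sub (hf.const_mul t)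
  have hr1 : Integrable r ν := hr.integrable one_le_two
  -- Integrating the product remainder over `y` gives the wanted marginal remainder with `s x`
  -- replaced by `s x * b`. By Jensen this does not increase the norm, and replacing `b` by `1`
  -- costs `2 * (1 - b) * s x`.
  have h1 : ∀ᵐ x ∂μ, ∫ y, (2 * (s x * r y - 1) - t * f (x, y)) ∂ν =
      2 * (s x * b - 1) - t * ∫ y, f (x, y) ∂ν := by
    filter_upwards [(hf.integrable one_le_two).prod_right_ae] with x hx
    have h2 : Integrable (fun y => 2 * (s x * r y - 1)) ν :=
      ((hr1.const_mul _).sub (integrable_const _)).const_mul _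
    rw [integral_sub h2 (hx.const_mul _), integral_const_mul, integral_const_mul,
      integral_sub (hr1.const_mul _) (integrable_const _),
      integral_const_mul]
    simp [hb]
  have h2 := integral_sq_integral_right_le hF
  have h3 : MemLp (fun x => 2 * (s x * b - 1) - t * ∫ y, f (x, y) ∂ν) 2 μ :=
    (memLp_integral_right hF).ae_eq h1
  have h4 := integral_add_sq_le h3 (hs.const_mul (2 * (1 - b)))
  have h5 : ∫ x, (2 * (s x * b - 1) - t * ∫ y, f (x, y) ∂ν) ^ 2 ∂μ ≤
      ∫ z, (2 * (s z.1 * r z.2 - 1) - t * f z) ^ 2 ∂μ.prod ν := by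
    refine le_trans (le_of_eq (integral_congr_ae ?_)) h2
    filter_upwards [h1] with x hx
    rw [hx]
  have h6 : ∫ x, (2 * (1 - b) * s x) ^ 2 ∂μ = 4 * (1 - b) ^ 2 * ∫ x, s x ^ 2 ∂μ := by
    simp only [mul_pow]
    rw [integral_const_mul]; norm_num
  calc _ = ∫ x, (2 * (s x * b - 1) - t * ∫ y, f (x, y) ∂ν + 2 * (1 - b) * s x) ^ 2 ∂μ := by
        congr 1; ext x; ring
    _ ≤ _ := by rw [h6] at h4; linarith

end Marginal

/-! ### Tangents of curves of product measures. -/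

namespace HasL2Tangent

variable {P : ℝ → ProbabilityMeasure Ω₁} {Q : ℝ → ProbabilityMeasure Ω₂} {g : Ω₁ × Ω₂ → ℝ}

/-- Needed because a curve in the product family factors only for `|t| < ε`. -/
lemma congr {R R' : ℝ → ProbabilityMeasure Ω} {g : Ω → ℝ} (h : HasL2Tangent R g)
    (h0 : R 0 = R' 0) (hR : R =ᶠ[𝓝[≠] 0] R') : HasL2Tangent R' g := by
  refine ⟨h0 ▸ h.memLp, h.remainder.congr' ?_ .rfl, h.singular.congr' ?_ .rfl⟩ <;>
  · filter_upwards [hR] with t ht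
    rw [h0, ht]

lemma integral_sub_one_sq_isBigO {P : ℝ → ProbabilityMeasure Ω} {g : Ω → ℝ}
    (h : HasL2Tangent P g) :
    (fun t : ℝ => ∫ ω, (sqrtDensity (P t : Measure Ω) (P 0) ω - 1) ^ 2 ∂(P 0 : Measure Ω))
      =O[𝓝[≠] 0] fun t : ℝ => t ^ 2 := by
  have h1 : (fun t : ℝ => 2 * ∫ ω, (2 * (sqrtDensity (P t : Measure Ω) (P 0) ω - 1) - t * g ω) ^ 2
      ∂(P 0 : Measure Ω) + 2 * (t ^ 2 * ∫ ω, g ω ^ 2 ∂(P 0 : Measure Ω))) =O[𝓝[≠] 0]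
      fun t : ℝ => t ^ 2 := by
    refine (h.remainder.isBigO.const_mul_left 2).add (IsBigO.const_mul_left ?_ 2)
    simp only [mul_comm (_ ^ 2 : ℝ)]
    exact (isBigO_refl _ _).const_mul_left _
  refine IsBigO.trans (IsBigO.of_bound 1 (.of_forall fun t => ?_)) h1
  have h2 := integral_add_sq_le (memLp_remainder (P := P t) h.memLp t) (h.memLp.const_mul t)
  simp only [sub_add_cancel, mul_pow] at h2
  rw [integral_const_mul, integral_const_mul] at h2
  have h3 : 0 ≤ ∫ ω, (sqrtDensity (P t : Measure Ω) (P 0) ω - 1) ^ 2 ∂(P 0 : Measure Ω) :=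
    integral_nonneg fun _ => sq_nonneg _
  rw [Real.norm_of_nonneg h3, one_mul]
  refine le_trans ?_ (le_abs_self _)
  linarith

lemma integral_sqrtDensity_le_one (P Q : ProbabilityMeasure Ω) :
    ∫ ω, sqrtDensity (P : Measure Ω) Q ω ∂(Q : Measure Ω) ≤ 1 := by
  have h1 := sq_integral_le_integral_sq (memLp_sqrtDensity (P : Measure Ω) Q).integrable_sq
  have h2 := integral_sqrtDensity_sq_le_one (P : Measure Ω) Q
  nlinarith

/-- From `2 (1 - ∫ s) = ∫ (s - 1)² + (1 - ∫ s²)`: the deficit of the affinity is of second order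
although `s - 1` is only of first order. -/
lemma one_sub_integral_isBigO {P : ℝ → ProbabilityMeasure Ω} {g : Ω → ℝ}
    (h : HasL2Tangent P g) :
    (fun t : ℝ => 1 - ∫ ω, sqrtDensity (P t : Measure Ω) (P 0) ω ∂(P 0 : Measure Ω))
      =O[𝓝[≠] 0] fun t : ℝ => t ^ 2 := by
  refine ((h.integral_sub_one_sq_isBigO.add h.singular.isBigO).const_mul_left (1 / 2)).congr_left
    fun t => ?_
  have hs := memLp_sqrtDensity (P t : Measure Ω) (P 0)
  set s := sqrtDensity (P t : Measure Ω) (P 0) with hs_def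
  have h1 : ∫ ω, (s ω - 1) ^ 2 ∂(P 0 : Measure Ω) =
      ∫ ω, s ω ^ 2 ∂(P 0 : Measure Ω) - 2 * ∫ ω, s ω ∂(P 0 : Measure Ω) + 1 := by
    have h2 : (fun ω => (s ω - 1) ^ 2) = fun ω => (s ω ^ 2 - 2 * s ω) + 1 := by ext; ring
    have h4 : Integrable s (P 0 : Measure Ω) := hs.integrable one_le_two
    have h3 : Integrable (fun ω => s ω ^ 2 - 2 * s ω) (P 0 : Measure Ω) :=
      hs.integrable_sq.sub (h4.const_mul _)
    rw [h2, integral_add h3 (integrable_const _), integral_sub hs.integrable_sq (h4.const_mul _),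
      integral_const_mul]
    simp
  rw [h1]; ring

/-- The hypotheses are stated separately so that the same argument serves both factors, the second
after swapping coordinates. -/
lemma of_product_remainder (hg : MemLp g 2 ((P 0 : Measure Ω₁).prod (Q 0 : Measure Ω₂)))
    (h1 : (fun t : ℝ => ∫ z, (2 * (sqrtDensity (P t : Measure Ω₁) (P 0) z.1 *
      sqrtDensity (Q t : Measure Ω₂) (Q 0) z.2 - 1) - t * g z) ^ 2
      ∂(P 0 : Measure Ω₁).prod (Q 0 : Measure Ω₂)) =o[𝓝[≠] 0] fun t : ℝ => t ^ 2)
    (h2 : (fun t : ℝ => 1 - ∫ ω, sqrtDensity (P t : Measure Ω₁) (P 0) ω ^ 2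
      ∂(P 0 : Measure Ω₁)) =o[𝓝[≠] 0] fun t : ℝ => t ^ 2)
    (h3 : (fun t : ℝ => 1 - ∫ ω, sqrtDensity (Q t : Measure Ω₂) (Q 0) ω ∂(Q 0 : Measure Ω₂))
      =O[𝓝[≠] 0] fun t : ℝ => t ^ 2) :
    HasL2Tangent P (fun x => ∫ y, g (x, y) ∂(Q 0 : Measure Ω₂)) := by
  refine ⟨memLp_integral_right hg, ?_, h2⟩
  -- The error from the other factor is the square of an `O(t²)` deficit, hence negligible.
  have h4 : (fun t : ℝ => (1 - ∫ ω, sqrtDensity (Q t : Measure Ω₂) (Q 0) ω ∂(Q 0 : Measure Ω₂)) ^ 2)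
      =o[𝓝[≠] 0] fun t : ℝ => t ^ 2 := by
    refine (h3.pow 2).trans_isLittleO ?_
    simp only [← pow_mul]
    exact (isLittleO_pow_pow (by norm_num)).mono nhdsWithin_le_nhds
  refine IsBigO.trans_isLittleO (IsBigO.of_bound 1 (.of_forall fun t => ?_))
    ((h1.const_mul_left 2).add (h4.const_mul_left 8))
  have h5 := integral_marginal_remainder_le (memLp_sqrtDensity (P t : Measure Ω₁) (P 0))
    (memLp_sqrtDensity (Q t : Measure Ω₂) (Q 0)) hg t
  have h6 := integral_sqrtDensity_sq_le_one (P t : Measure Ω₁) (P 0)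
  rw [Real.norm_of_nonneg (integral_nonneg fun _ => sq_nonneg _), one_mul]
  refine le_trans (h5.trans ?_) (le_abs_self _)
  have := mul_le_mul_of_nonneg_right h6
    (sq_nonneg (1 - ∫ ω, sqrtDensity (Q t : Measure Ω₂) (Q 0) ω ∂(Q 0 : Measure Ω₂)))
  linarith

lemma memLp_prod (h : HasL2Tangent (fun t => (P t).prod (Q t)) g) :
    MemLp g 2 ((P 0 : Measure Ω₁).prod (Q 0 : Measure Ω₂)) := h.memLp

lemma remainder_prod (h : HasL2Tangent (fun t => (P t).prod (Q t)) g) :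
    (fun t : ℝ => ∫ z, (2 * (sqrtDensity (P t : Measure Ω₁) (P 0) z.1 *
      sqrtDensity (Q t : Measure Ω₂) (Q 0) z.2 - 1) - t * g z) ^ 2
      ∂(P 0 : Measure Ω₁).prod (Q 0 : Measure Ω₂)) =o[𝓝[≠] 0] fun t : ℝ => t ^ 2 := by
  refine h.remainder.congr_left fun t => ?_
  simp only [ProbabilityMeasure.toMeasure_prod]
  refine integral_congr_ae ?_
  filter_upwards [sqrtDensity_prod_ae_eq (P t : Measure Ω₁) (P 0) (Q t : Measure Ω₂) (Q 0)]
    with z hz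
  rw [hz]

lemma singular_prod (h : HasL2Tangent (fun t => (P t).prod (Q t)) g) :
    (fun t : ℝ => 1 - (∫ x, sqrtDensity (P t : Measure Ω₁) (P 0) x ^ 2
      ∂(P 0 : Measure Ω₁)) * ∫ y, sqrtDensity (Q t : Measure Ω₂) (Q 0) y ^ 2
      ∂(Q 0 : Measure Ω₂)) =o[𝓝[≠] 0] fun t : ℝ => t ^ 2 := by
  refine h.singular.congr_left fun t => ?_
  simp only [ProbabilityMeasure.toMeasure_prod]
  rw [← integral_sq_mul_prod]
  congr 1
  refine integral_congr_ae ?_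
  filter_upwards [sqrtDensity_prod_ae_eq (P t : Measure Ω₁) (P 0) (Q t : Measure Ω₂) (Q 0)]
    with z hz
  rw [hz]

lemma one_sub_integral_prod_isBigO (h : HasL2Tangent (fun t => (P t).prod (Q t)) g) :
    (fun t : ℝ => 1 - (∫ x, sqrtDensity (P t : Measure Ω₁) (P 0) x ∂(P 0 : Measure Ω₁)) *
      ∫ y, sqrtDensity (Q t : Measure Ω₂) (Q 0) y ∂(Q 0 : Measure Ω₂))
      =O[𝓝[≠] 0] fun t : ℝ => t ^ 2 := by
  refine h.one_sub_integral_isBigO.congr_left fun t => ?_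
  simp only [ProbabilityMeasure.toMeasure_prod]
  rw [← integral_prod_mul]
  congr 1
  exact integral_congr_ae (sqrtDensity_prod_ae_eq _ _ _ _)

/-- Since `a * b ≤ a`, a deficit of the product bounds the deficit of each factor. Applied to masses
of absolutely continuous parts and to affinities, this transfers rates from the product to its
factors. -/
lemma _root_.TwoSample.isBigO_one_sub_mul {a b : ℝ → ℝ} (ha : ∀ t, 0 ≤ a t) (ha' : ∀ t, a t ≤ 1)
    (hb : ∀ t, b t ≤ 1) : (fun t => 1 - a t) =O[𝓝[≠] 0] fun t => 1 - a t * b t := by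
  refine IsBigO.of_bound 1 (.of_forall fun t => ?_)
  have h1 := mul_le_mul_of_nonneg_left (hb t) (ha t)
  rw [one_mul, Real.norm_of_nonneg (by linarith [ha' t])]
  exact le_trans (by linarith) (le_abs_self _)

lemma _root_.TwoSample.isBigO_one_sub_mul' {a b : ℝ → ℝ} (ha : ∀ t, 0 ≤ a t) (ha' : ∀ t, a t ≤ 1)
    (hb : ∀ t, b t ≤ 1) : (fun t => 1 - a t) =O[𝓝[≠] 0] fun t => 1 - b t * a t := by
  simp only [mul_comm (b _)]
  exact isBigO_one_sub_mul ha ha' hb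

lemma fst (h : HasL2Tangent (fun t => (P t).prod (Q t)) g) :
    HasL2Tangent P (fun x => ∫ y, g (x, y) ∂(Q 0 : Measure Ω₂)) := by
  refine of_product_remainder h.memLp_prod h.remainder_prod ?_ ?_
  · exact (isBigO_one_sub_mul (fun t => integral_nonneg fun _ => sq_nonneg _)
      (fun t => integral_sqrtDensity_sq_le_one _ _)
      fun t => integral_sqrtDensity_sq_le_one _ _).trans_isLittleO h.singular_prod
  · exact (isBigO_one_sub_mul' (fun t => integral_nonneg fun _ => sqrtDensity_nonneg _ _ _)
      (fun t => integral_sqrtDensity_le_one _ _)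
      fun t => integral_sqrtDensity_le_one _ _).trans h.one_sub_integral_prod_isBigO

lemma snd (h : HasL2Tangent (fun t => (P t).prod (Q t)) g) :
    HasL2Tangent Q (fun y => ∫ x, g (x, y) ∂(P 0 : Measure Ω₁)) := by
  refine of_product_remainder (P := Q) (Q := P) (g := fun z => g z.swap)
    (MemLp.swap_prod h.memLp_prod) (h.remainder_prod.congr_left fun t => ?_) ?_ ?_
  · rw [← integral_prod_swap]
    simp only [Prod.fst_swap, Prod.snd_swap, mul_comm]
  · exact (isBigO_one_sub_mul' (fun t => integral_nonneg fun _ => sq_nonneg _)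
      (fun t => integral_sqrtDensity_sq_le_one _ _)
      fun t => integral_sqrtDensity_sq_le_one _ _).trans_isLittleO h.singular_prod
  · exact (isBigO_one_sub_mul (fun t => integral_nonneg fun _ => sqrtDensity_nonneg _ _ _)
      (fun t => integral_sqrtDensity_le_one _ _)
      fun t => integral_sqrtDensity_le_one _ _).trans h.one_sub_integral_prod_isBigO

/-- In `s r - 1 = (s - 1) + (r - 1) + (s - 1)(r - 1)` the last term has squared norm `O(t⁴)`.
Comparing the expansions of both sides, `t (g - g₁ - g₂)` has squared norm `o(t²)`; this squared
norm is `t² D` with `D` constant, so `D = 0`. -/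
lemma ae_eq_add (h : HasL2Tangent (fun t => (P t).prod (Q t)) g) :
    g =ᵐ[(P 0 : Measure Ω₁).prod (Q 0 : Measure Ω₂)]
    fun z => ∫ y, g (z.1, y) ∂(Q 0 : Measure Ω₂) + ∫ x, g (x, z.2) ∂(P 0 : Measure Ω₁) := by
  set g₁ : Ω₁ → ℝ := fun x => ∫ y, g (x, y) ∂(Q 0 : Measure Ω₂)
  set g₂ : Ω₂ → ℝ := fun y => ∫ x, g (x, y) ∂(P 0 : Measure Ω₁)
  have hP : HasL2Tangent P g₁ := h.fst
  have hQ : HasL2Tangent Q g₂ := h.snd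
  have hD : MemLp (fun z : Ω₁ × Ω₂ => g z - (g₁ z.1 + g₂ z.2)) 2
      ((P 0 : Measure Ω₁).prod (Q 0 : Measure Ω₂)) :=
    h.memLp_prod.sub ((memLp_fst hP.memLp).add (memLp_snd hQ.memLp))
  set D := ∫ z, (g z - (g₁ z.1 + g₂ z.2)) ^ 2 ∂(P 0 : Measure Ω₁).prod (Q 0 : Measure Ω₂) with hDdef
  have hD0 : 0 ≤ D := integral_nonneg fun _ => sq_nonneg _
  have h1 : (fun t : ℝ => (∫ x, (sqrtDensity (P t : Measure Ω₁) (P 0) x - 1) ^ 2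
      ∂(P 0 : Measure Ω₁)) * ∫ y, (sqrtDensity (Q t : Measure Ω₂) (Q 0) y - 1) ^ 2
      ∂(Q 0 : Measure Ω₂)) =o[𝓝[≠] 0] fun t : ℝ => t ^ 2 := by
    refine (hP.integral_sub_one_sq_isBigO.mul hQ.integral_sub_one_sq_isBigO).trans_isLittleO ?_
    simp only [← pow_add]
    exact (isLittleO_pow_pow (by norm_num)).mono nhdsWithin_le_nhds
  have h2 : (fun t : ℝ => t ^ 2 * D) =o[𝓝[≠] 0] fun t : ℝ => t ^ 2 := by
    -- The constants 2, 8, 8, 16 come from three uses of `(u + v)² ≤ 2 u² + 2 v²`, and from the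
    -- factor 4 in the square of `2 (s - 1)(r - 1)`.
    refine IsBigO.trans_isLittleO (IsBigO.of_bound 1 (.of_forall fun t => ?_))
      ((h.remainder_prod.const_mul_left 2).add (((hP.remainder.const_mul_left 8).add
        (hQ.remainder.const_mul_left 8)).add (h1.const_mul_left 16)))
    rw [one_mul, Real.norm_of_nonneg (mul_nonneg (sq_nonneg t) hD0)]
    refine le_trans ?_ (le_abs_self _)
    set s := sqrtDensity (P t : Measure Ω₁) (P 0)
    set r := sqrtDensity (Q t : Measure Ω₂) (Q 0)
    have hs : MemLp s 2 (P 0 : Measure Ω₁) := memLp_sqrtDensity _ _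
    have hr : MemLp r 2 (Q 0 : Measure Ω₂) := memLp_sqrtDensity _ _
    have ms : MemLp (fun z : Ω₁ × Ω₂ => 2 * (s z.1 - 1) - t * g₁ z.1) 2
      ((P 0 : Measure Ω₁).prod (Q 0 : Measure Ω₂)) := memLp_fst (memLp_remainder hP.memLp t)
    have mr : MemLp (fun z : Ω₁ × Ω₂ => 2 * (r z.2 - 1) - t * g₂ z.2) 2
      ((P 0 : Measure Ω₁).prod (Q 0 : Measure Ω₂)) := memLp_snd (memLp_remainder hQ.memLp t)
    have ms1 : MemLp (fun x => s x - 1) 2 (P 0 : Measure Ω₁) := hs.sub (memLp_const 1)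
    have mr1 : MemLp (fun y => r y - 1) 2 (Q 0 : Measure Ω₂) := hr.sub (memLp_const 1)
    have msr := (memLp_mul_prod ms1 mr1).const_mul 2
    have mE : MemLp (fun z : Ω₁ × Ω₂ => 2 * (s z.1 * r z.2 - 1) - t * g z) 2
      ((P 0 : Measure Ω₁).prod (Q 0 : Measure Ω₂)) :=
      (((memLp_mul_prod hs hr).sub (memLp_const 1)).const_mul 2).sub (h.memLp_prod.const_mul t)
    have e1 := integral_add_sq_le (ms.add mr) msr
    have e2 := integral_add_sq_le ms mr
    have e3 := integral_add_sq_le mE.neg ((ms.add mr).add msr)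
    have e4 : ∫ z : Ω₁ × Ω₂, (2 * (s z.1 - 1) - t * g₁ z.1) ^ 2
        ∂(P 0 : Measure Ω₁).prod (Q 0 : Measure Ω₂) =
        ∫ x, (2 * (s x - 1) - t * g₁ x) ^ 2 ∂(P 0 : Measure Ω₁) := by
      rw [integral_fun_fst (fun x => (2 * (s x - 1) - t * g₁ x) ^ 2)]; simp
    have e5 : ∫ z : Ω₁ × Ω₂, (2 * (r z.2 - 1) - t * g₂ z.2) ^ 2
        ∂(P 0 : Measure Ω₁).prod (Q 0 : Measure Ω₂) =
        ∫ y, (2 * (r y - 1) - t * g₂ y) ^ 2 ∂(Q 0 : Measure Ω₂) := by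
      rw [integral_fun_snd (fun y => (2 * (r y - 1) - t * g₂ y) ^ 2)]; simp
    have e6 : ∫ z : Ω₁ × Ω₂, (2 * ((s z.1 - 1) * (r z.2 - 1))) ^ 2
        ∂(P 0 : Measure Ω₁).prod (Q 0 : Measure Ω₂) =
        4 * ((∫ x, (s x - 1) ^ 2 ∂(P 0 : Measure Ω₁)) * ∫ y, (r y - 1) ^ 2 ∂(Q 0 : Measure Ω₂)) := by
      rw [← integral_sq_mul_prod (fun x => s x - 1) fun y => r y - 1, ← integral_const_mul]
      congr 1; ext z; ring
    have e7 : t ^ 2 * D = ∫ z, (t * (g z - (g₁ z.1 + g₂ z.2))) ^ 2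
        ∂(P 0 : Measure Ω₁).prod (Q 0 : Measure Ω₂) := by
      simp only [mul_pow]; rw [integral_const_mul]
    have e8 : ∫ z, (t * (g z - (g₁ z.1 + g₂ z.2))) ^ 2 ∂(P 0 : Measure Ω₁).prod (Q 0 : Measure Ω₂)
        = ∫ z : Ω₁ × Ω₂, (-(2 * (s z.1 * r z.2 - 1) - t * g z) +
          ((2 * (s z.1 - 1) - t * g₁ z.1) + (2 * (r z.2 - 1) - t * g₂ z.2) +
          2 * ((s z.1 - 1) * (r z.2 - 1)))) ^ 2 ∂(P 0 : Measure Ω₁).prod (Q 0 : Measure Ω₂) := by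
      congr 1; ext z; ring
    simp only [Pi.add_apply, Pi.neg_apply, neg_sq] at e1 e2 e3
    rw [e6] at e1
    rw [e4, e5] at e2
    rw [e7, e8]
    linarith
  have h3 : D = 0 := by
    by_contra hne
    have h4 : (fun t : ℝ => t ^ 2) =o[𝓝[≠] 0] fun t : ℝ => t ^ 2 := by
      have := h2.const_mul_left D⁻¹
      refine this.congr_left fun t => ?_
      field_simp
    have h5 := isLittleO_irrefl' (f' := fun t : ℝ => t ^ 2) (l := 𝓝[≠] (0 : ℝ)) ?_ h4
    · exact h5
    · refine Eventually.frequently ?_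
      filter_upwards [self_mem_nhdsWithin] with t ht
      have : t ≠ 0 := ht
      simpa using this
  rw [hDdef, integral_eq_zero_iff_of_nonneg (fun _ => sq_nonneg _) hD.integrable_sq] at h3
  filter_upwards [h3] with z hz
  have : g z - (g₁ z.1 + g₂ z.2) = 0 := by simpa using hz
  linarith

end HasL2Tangent
-- Limits of integrals and expansion of characteristic functions.
lemma integral_abs_mul_le_sqrt {μ : Measure Ω} {f h : Ω → ℝ} (hf : MemLp f 2 μ) (hh : MemLp h 2 μ) :
    ∫ ω, |f ω| * |h ω| ∂μ ≤ √(∫ ω, f ω ^ 2 ∂μ) * √(∫ ω, h ω ^ 2 ∂μ) := by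
  have h2 : ENNReal.ofReal 2 = 2 := by simp
  have := integral_mul_norm_le_Lp_mul_Lq (μ := μ) (f := f) (g := h) (p := 2) (q := 2)
    Real.HolderConjugate.two_two (by rwa [h2]) (by rwa [h2])
  simpa [Real.sqrt_eq_rpow] using this

/-- Split `Y n = Y' + (Y n - Y')`: dominated convergence handles the first part, Cauchy–Schwarz the
second. -/
lemma tendsto_integral_mul_of_tendsto_l2 {μ : Measure Ω} {X : ℕ → Ω → ℂ} {X' : Ω → ℂ} {f : Ω → ℝ}
    {Y : ℕ → Ω → ℝ} {Y' : Ω → ℝ} (hf : MemLp f 2 μ) (hX : ∀ n, AEStronglyMeasurable (X n) μ)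
    {C : ℝ} (hXb : ∀ᶠ n in atTop, ∀ ω, ‖X n ω‖ ≤ C * |f ω|)
    (hXlim : ∀ ω, Tendsto (fun n => X n ω) atTop (𝓝 (X' ω)))
    (hY : ∀ n, MemLp (Y n) 2 μ) (hY' : MemLp Y' 2 μ)
    (hYlim : Tendsto (fun n => ∫ ω, (Y n ω - Y' ω) ^ 2 ∂μ) atTop (𝓝 0)) :
    Tendsto (fun n => ∫ ω, X n ω * Y n ω ∂μ) atTop (𝓝 (∫ ω, X' ω * Y' ω ∂μ)) := by
  have hfY (h : Ω → ℝ) (hh : MemLp h 2 μ) : Integrable (fun ω => C * (|f ω| * |h ω|)) μ :=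
    (hf.abs.integrable_mul hh.abs).const_mul C
  have hint (h : Ω → ℝ) (hh : MemLp h 2 μ) (n : ℕ) (hn : ∀ ω, ‖X n ω‖ ≤ C * |f ω|) :
      Integrable (fun ω => X n ω * h ω) μ := by
    refine (hfY h hh).mono' ((hX n).mul (Complex.continuous_ofReal.comp_aestronglyMeasurable
      hh.aestronglyMeasurable)) (.of_forall fun ω => ?_)
    rw [norm_mul, Complex.norm_real, ← mul_assoc]
    exact mul_le_mul_of_nonneg_right (hn ω) (norm_nonneg _)
  have h1 : Tendsto (fun n => ∫ ω, X n ω * Y' ω ∂μ) atTop (𝓝 (∫ ω, X' ω * Y' ω ∂μ)) := by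
    refine tendsto_integral_filter_of_dominated_convergence (fun ω => C * (|f ω| * |Y' ω|))
      (.of_forall fun n => (hX n).mul (Complex.continuous_ofReal.comp_aestronglyMeasurable
        hY'.aestronglyMeasurable)) ?_ (hfY Y' hY')
      (.of_forall fun ω => (hXlim ω).mul_const _)
    filter_upwards [hXb] with n hn
    refine .of_forall fun ω => ?_
    rw [norm_mul, Complex.norm_real, ← mul_assoc]
    exact mul_le_mul_of_nonneg_right (hn ω) (norm_nonneg _)
  have h2 : Tendsto (fun n => ∫ ω, X n ω * (Y n ω - Y' ω : ℝ) ∂μ) atTop (𝓝 0) := by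
    have h3 : Tendsto (fun n => |C| * (√(∫ ω, f ω ^ 2 ∂μ) * √(∫ ω, (Y n ω - Y' ω) ^ 2 ∂μ))) atTop
        (𝓝 0) := by
      simpa using (((Real.continuous_sqrt.tendsto _).comp hYlim).const_mul
        √(∫ ω, f ω ^ 2 ∂μ)).const_mul |C|
    refine squeeze_zero_norm' ?_ h3
    filter_upwards [hXb] with n hn
    have hd : MemLp (fun ω => Y n ω - Y' ω) 2 μ := (hY n).sub hY'
    calc ‖∫ ω, X n ω * (Y n ω - Y' ω : ℝ) ∂μ‖ ≤ ∫ ω, C * (|f ω| * |Y n ω - Y' ω|) ∂μ := by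
          refine norm_integral_le_of_norm_le (hfY _ hd) (.of_forall fun ω => ?_)
          rw [norm_mul, Complex.norm_real, ← mul_assoc]
          exact mul_le_mul_of_nonneg_right (hn ω) (norm_nonneg _)
      _ = C * ∫ ω, |f ω| * |Y n ω - Y' ω| ∂μ := integral_const_mul _ _
      _ ≤ |C| * ∫ ω, |f ω| * |Y n ω - Y' ω| ∂μ :=
          mul_le_mul_of_nonneg_right (le_abs_self C) (integral_nonneg fun _ => by positivity)
      _ ≤ _ := mul_le_mul_of_nonneg_left (integral_abs_mul_le_sqrt hf hd) (abs_nonneg C)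
  have h4 := h1.add h2
  rw [add_zero] at h4
  refine h4.congr' ?_
  filter_upwards [hXb] with n hn
  rw [← integral_add (hint _ hY' n hn) (hint (fun ω => Y n ω - Y' ω) ((hY n).sub hY') n hn)]
  congr 1; ext ω; push_cast; ring

/-- The bound `(Y n)² ≤ 2 Y'² + 2 (Y n - Y')²` leaves a fixed integrable function, treated by
dominated convergence, and a term that vanishes because `Z n` is uniformly bounded. -/
lemma tendsto_integral_mul_sq_zero {μ : Measure Ω} {Z : ℕ → Ω → ℂ}
    {Y : ℕ → Ω → ℝ} {Y' : Ω → ℝ} (hZ : ∀ n, AEStronglyMeasurable (Z n) μ)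
    {C : ℝ} (hZb : ∀ n, ∀ ω, ‖Z n ω‖ ≤ C)
    (hZlim : ∀ ω, Tendsto (fun n => Z n ω) atTop (𝓝 0))
    (hY : ∀ n, MemLp (Y n) 2 μ) (hY' : MemLp Y' 2 μ)
    (hYlim : Tendsto (fun n => ∫ ω, (Y n ω - Y' ω) ^ 2 ∂μ) atTop (𝓝 0)) :
    Tendsto (fun n => ∫ ω, Z n ω * (Y n ω : ℂ) ^ 2 ∂μ) atTop (𝓝 0) := by
  have hm (n : ℕ) : AEStronglyMeasurable (fun ω => ‖Z n ω‖ * Y' ω ^ 2) μ :=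
    (hZ n).norm.mul (hY'.aestronglyMeasurable.pow 2)
  have hb (n : ℕ) (ω : Ω) : ‖(‖Z n ω‖ * Y' ω ^ 2)‖ ≤ C * Y' ω ^ 2 := by
    rw [Real.norm_of_nonneg (by positivity)]
    exact mul_le_mul_of_nonneg_right (hZb n ω) (sq_nonneg _)
  have h1 : Tendsto (fun n => ∫ ω, ‖Z n ω‖ * Y' ω ^ 2 ∂μ) atTop (𝓝 0) := by
    have := tendsto_integral_of_dominated_convergence (fun ω => C * Y' ω ^ 2) hm
      (hY'.integrable_sq.const_mul C) (fun n => .of_forall (hb n))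
      (.of_forall fun ω => (hZlim ω).norm.mul_const (Y' ω ^ 2))
    simpa using this
  have h2 : Tendsto (fun n => 2 * ∫ ω, ‖Z n ω‖ * Y' ω ^ 2 ∂μ +
      2 * C * ∫ ω, (Y n ω - Y' ω) ^ 2 ∂μ) atTop (𝓝 0) := by
    simpa using (h1.const_mul 2).add (hYlim.const_mul (2 * C))
  refine squeeze_zero_norm (fun n => ?_) h2
  have hd : MemLp (fun ω => Y n ω - Y' ω) 2 μ := (hY n).sub hY'
  have hi : Integrable (fun ω => ‖Z n ω‖ * Y' ω ^ 2) μ :=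
    (hY'.integrable_sq.const_mul C).mono' (hm n) (.of_forall (hb n))
  rw [← integral_const_mul, ← integral_const_mul, ← integral_add (hi.const_mul 2)
    (hd.integrable_sq.const_mul _)]
  refine norm_integral_le_of_norm_le ((hi.const_mul 2).add (hd.integrable_sq.const_mul _))
    (.of_forall fun ω => ?_)
  rw [norm_mul, norm_pow, Complex.norm_real, Real.norm_eq_abs, sq_abs]
  have h3 : Y n ω ^ 2 ≤ 2 * Y' ω ^ 2 + 2 * (Y n ω - Y' ω) ^ 2 := by
    nlinarith [sq_nonneg (Y n ω - Y' ω - Y' ω)]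
  have h4 := mul_le_mul_of_nonneg_left h3 (norm_nonneg (Z n ω))
  have h5 := mul_le_mul_of_nonneg_right (hZb n ω) (sq_nonneg (Y n ω - Y' ω))
  linarith

/-- The difference is the integral of `e` over the singular part of `P`, whose mass is the
right-hand side. -/
lemma norm_integral_sub_integral_sqrtDensity_sq_mul_le (P Q : Measure Ω) [IsProbabilityMeasure P]
    [IsProbabilityMeasure Q] {e : Ω → ℂ} (he : Measurable e) (he1 : ∀ ω, ‖e ω‖ ≤ 1) :
    ‖∫ ω, e ω ∂P - ∫ ω, (sqrtDensity P Q ω : ℂ) ^ 2 * e ω ∂Q‖ ≤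
      1 - ∫ ω, sqrtDensity P Q ω ^ 2 ∂Q := by
  have hint (μ : Measure Ω) [IsFiniteMeasure μ] : Integrable e μ :=
    (integrable_const (1 : ℝ)).mono' he.aestronglyMeasurable (.of_forall he1)
  have h1 : P = P.singularPart Q + Q.withDensity (P.rnDeriv Q) :=
    P.haveLebesgueDecomposition_add Q
  have h2 : ∫ ω, e ω ∂Q.withDensity (P.rnDeriv Q) =
      ∫ ω, (sqrtDensity P Q ω : ℂ) ^ 2 * e ω ∂Q := by
    rw [integral_withDensity_eq_integral_toReal_smul (Measure.measurable_rnDeriv P Q)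
      (Measure.rnDeriv_lt_top P Q)]
    refine integral_congr_ae (.of_forall fun ω => ?_)
    simp only [← sqrtDensity_sq]
    rw [Complex.real_smul]; push_cast; rfl
  have h3 : ∫ ω, e ω ∂P = ∫ ω, e ω ∂P.singularPart Q +
      ∫ ω, (sqrtDensity P Q ω : ℂ) ^ 2 * e ω ∂Q := by
    rw [← h2, ← integral_add_measure (hint _) (hint _), ← h1]
  have h4 : (P.singularPart Q).real Set.univ = 1 - ∫ ω, sqrtDensity P Q ω ^ 2 ∂Q := by
    have h5 : ∫ ω, sqrtDensity P Q ω ^ 2 ∂Q =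
        (Q.withDensity (P.rnDeriv Q)).real Set.univ := by
      simp only [sqrtDensity_sq]
      rw [integral_toReal (Measure.measurable_rnDeriv P Q).aemeasurable
        (Measure.rnDeriv_lt_top P Q), Measure.real, withDensity_apply _ .univ, Measure.restrict_univ]
    have h6 : P.real Set.univ = (P.singularPart Q).real Set.univ +
        (Q.withDensity (P.rnDeriv Q)).real Set.univ := by
      conv_lhs => rw [h1]
      exact measureReal_add_apply
    rw [h5]
    simp only [probReal_univ] at h6
    linarith
  rw [h3, add_sub_cancel_right, ← h4]
  simpa using norm_integral_le_of_norm_le_const (μ := P.singularPart Q) (.of_forall he1)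

lemma tendsto_zero_of_sqrt_mul {x : ℕ → ℝ} {y : ℝ}
    (h : Tendsto (fun n : ℕ => x n * √(n : ℝ)) atTop (𝓝 y)) : Tendsto x atTop (𝓝 0) := by
  have h1 : Tendsto (fun n : ℕ => √(n : ℝ)) atTop atTop :=
    Real.tendsto_sqrt_atTop.comp tendsto_natCast_atTop_atTop
  refine (h.div_atTop h1).congr' ?_
  filter_upwards [eventually_gt_atTop 0] with n hn
  have : √(n : ℝ) ≠ 0 := by positivity
  field_simp

lemma tendsto_nat_mul_exp_sub {x : ℕ → ℝ} {y : ℝ}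
    (h : Tendsto (fun n : ℕ => x n * √(n : ℝ)) atTop (𝓝 y)) :
    Tendsto (fun n : ℕ => (n : ℂ) * (Complex.exp (x n * Complex.I) - 1 - x n * Complex.I)) atTop
      (𝓝 (-(y : ℂ) ^ 2 / 2)) := by
  have hx := tendsto_zero_of_sqrt_mul h
  have h2 : Tendsto (fun n : ℕ => (n : ℝ) * x n ^ 2) atTop (𝓝 (y ^ 2)) := by
    refine (h.pow 2).congr fun n => ?_
    rw [mul_pow, Real.sq_sqrt (Nat.cast_nonneg n), mul_comm]
  have h3 : Tendsto (fun n : ℕ => ((n : ℝ) * x n ^ 2) * (|x n| * Real.exp |x n|)) atTop (𝓝 0) := by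
    have := h2.mul (hx.abs.mul ((Real.continuous_exp.tendsto _).comp hx.abs))
    simpa using this
  have h4 : Tendsto (fun n : ℕ => (n : ℂ) * (Complex.exp (x n * Complex.I) - 1 - x n * Complex.I -
      (x n * Complex.I) ^ 2 / 2)) atTop (𝓝 0) := by
    refine squeeze_zero_norm (fun n => ?_) h3
    have h5 := Complex.norm_exp_sub_sum_le_norm_mul_exp (x n * Complex.I) 3
    simp only [Finset.sum_range_succ, Finset.range_zero, Finset.sum_empty, norm_mul,
      Complex.norm_I, Complex.norm_real, mul_one, Real.norm_eq_abs] at h5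
    rw [norm_mul, Complex.norm_natCast, mul_assoc]
    refine mul_le_mul_of_nonneg_left ?_ (Nat.cast_nonneg n)
    calc _ ≤ |x n| ^ 3 * Real.exp |x n| := by
          refine le_trans (le_of_eq ?_) h5
          congr 1
          simp [Nat.factorial]
          ring
      _ = _ := by rw [← sq_abs (x n)]; ring
  have h6 : Tendsto (fun n : ℕ => (((n : ℝ) * x n ^ 2 : ℝ) : ℂ)) atTop (𝓝 ((y ^ 2 : ℝ) : ℂ)) :=
    (Complex.continuous_ofReal.tendsto _).comp h2
  have h7 := h4.sub (h6.div_const 2)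
  rw [show (0 : ℂ) - ((y ^ 2 : ℝ) : ℂ) / 2 = -(y : ℂ) ^ 2 / 2 by push_cast; ring] at h7
  refine h7.congr fun n => ?_
  push_cast
  rw [mul_pow, Complex.I_sq]
  ring

lemma tendsto_sqrt_mul_exp_sub_one {x : ℕ → ℝ} {y : ℝ}
    (h : Tendsto (fun n : ℕ => x n * √(n : ℝ)) atTop (𝓝 y)) :
    Tendsto (fun n : ℕ => (√(n : ℝ) : ℂ) * (Complex.exp (x n * Complex.I) - 1)) atTop
      (𝓝 (y * Complex.I)) := by
  have h1 : Tendsto (fun n : ℕ => √(n : ℝ)) atTop atTop :=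
    Real.tendsto_sqrt_atTop.comp tendsto_natCast_atTop_atTop
  have h2 : Tendsto (fun n : ℕ => (((√(n : ℝ))⁻¹ : ℝ) : ℂ)) atTop (𝓝 ((0 : ℝ) : ℂ)) :=
    (Complex.continuous_ofReal.tendsto _).comp (tendsto_inv_atTop_zero.comp h1)
  have h3 := (((Complex.continuous_ofReal.tendsto _).comp h).mul_const Complex.I).add
    (h2.mul (tendsto_nat_mul_exp_sub h))
  rw [Complex.ofReal_zero, zero_mul, add_zero] at h3
  refine h3.congr' ?_
  filter_upwards [eventually_gt_atTop 0] with n hn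
  have h4 : (√(n : ℝ) : ℂ) ≠ 0 := by
    rw [Complex.ofReal_ne_zero]; positivity
  have h5 : (n : ℂ) = (√(n : ℝ) : ℂ) ^ 2 := by
    rw [← Complex.ofReal_pow, Real.sq_sqrt (Nat.cast_nonneg n)]; simp
  simp only [Function.comp_apply]
  rw [h5]
  push_cast
  field_simp
  ring

lemma norm_exp_mul_I_sub_one_le (x : ℝ) : ‖Complex.exp (x * Complex.I) - 1‖ ≤ |x| := by
  rw [mul_comm]; exact Real.norm_exp_I_mul_ofReal_sub_one_le

/-- A global quadratic bound, so that a multiple of `f²` dominates the second-order term. -/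
lemma norm_exp_mul_I_sub_one_sub_le (x : ℝ) :
    ‖Complex.exp (x * Complex.I) - 1 - x * Complex.I‖ ≤ 2 * x ^ 2 := by
  rcases le_total |x| 1 with h | h
  · have h1 := Complex.norm_exp_sub_one_sub_id_le (x := x * Complex.I) (by simpa using h)
    simp only [norm_mul, Complex.norm_I, Complex.norm_real, mul_one, Real.norm_eq_abs, sq_abs] at h1
    nlinarith [sq_nonneg x]
  · calc _ ≤ ‖Complex.exp (x * Complex.I) - 1‖ + ‖x * Complex.I‖ := norm_sub_le _ _
      _ ≤ |x| + |x| := add_le_add (norm_exp_mul_I_sub_one_le x) (by simp)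
      _ ≤ 2 * x ^ 2 := by rw [← sq_abs x]; nlinarith

/-- First-order expansion of the characteristic function of `f` under local alternatives. -/
lemma HasL2Tangent.tendsto_nat_mul_integral_exp_sub_one {P : ℝ → ProbabilityMeasure Ω} {g : Ω → ℝ}
    (h : HasL2Tangent P g) {f : Ω → ℝ} (hfm : Measurable f) (hf : MemLp f 2 (P 0 : Measure Ω))
    (hf0 : ∫ ω, f ω ∂(P 0 : Measure Ω) = 0) {t a : ℕ → ℝ} {τ A : ℝ} (hτ : 0 < τ)
    (ht : Tendsto (fun n : ℕ => t n * √(n : ℝ)) atTop (𝓝 τ))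
    (ha : Tendsto (fun n : ℕ => a n * √(n : ℝ)) atTop (𝓝 A)) :
    Tendsto (fun n : ℕ => (n : ℂ) * (∫ ω, Complex.exp ((a n * f ω : ℝ) * Complex.I)
      ∂(P (t n) : Measure Ω) - 1)) atTop
      (𝓝 (((A * τ * ∫ ω, f ω * g ω ∂(P 0 : Measure Ω) : ℝ) : ℂ) * Complex.I -
        ((A ^ 2 * ∫ ω, f ω ^ 2 ∂(P 0 : Measure Ω) : ℝ) : ℂ) / 2)) := by
  set μ : Measure Ω := (P 0 : Measure Ω) with hμ
  have ht0 : Tendsto t atTop (𝓝[≠] 0) := by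
    refine tendsto_nhdsWithin_iff.2 ⟨tendsto_zero_of_sqrt_mul ht, ?_⟩
    filter_upwards [ht.eventually (lt_mem_nhds hτ)] with n hn h0
    rw [Set.mem_singleton_iff] at h0
    simp [h0] at hn
  have hnt : Tendsto (fun n : ℕ => (n : ℝ) * t n ^ 2) atTop (𝓝 (τ ^ 2)) := by
    refine (ht.pow 2).congr fun n => ?_
    rw [mul_pow, Real.sq_sqrt (Nat.cast_nonneg n), mul_comm]
  have hlittle {u : ℝ → ℝ} (hu : u =o[𝓝[≠] 0] fun s : ℝ => s ^ 2) :
      Tendsto (fun n : ℕ => (n : ℝ) * u (t n)) atTop (𝓝 0) := by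
    have h1 := (hu.comp_tendsto ht0).tendsto_div_nhds_zero
    have h2 := h1.mul hnt
    rw [zero_mul] at h2
    refine h2.congr' ?_
    filter_upwards [ht0.eventually self_mem_nhdsWithin] with n hn
    have : t n ≠ 0 := hn
    simp only [Function.comp_apply]
    field_simp
  set s : ℕ → Ω → ℝ := fun n => sqrtDensity (P (t n) : Measure Ω) μ with hs
  have hsL (n : ℕ) : MemLp (s n) 2 μ := memLp_sqrtDensity _ _
  set e : ℕ → Ω → ℂ := fun n ω => Complex.exp ((a n * f ω : ℝ) * Complex.I) with he
  have hem (n : ℕ) : Measurable (e n) := by fun_prop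
  have he1 (n : ℕ) (ω : Ω) : ‖e n ω‖ = 1 := Complex.norm_exp_ofReal_mul_I _
  have haf (ω : Ω) : Tendsto (fun n : ℕ => a n * f ω * √(n : ℝ)) atTop (𝓝 (A * f ω)) :=
    (ha.mul_const (f ω)).congr fun n => by ring
  -- The rescaled increment of the root density; it converges to `τ g` in `L₂`.
  set Y : ℕ → Ω → ℝ := fun n ω => 2 * √(n : ℝ) * (s n ω - 1) with hYdef
  have hY (n : ℕ) : MemLp (Y n) 2 μ := ((hsL n).sub (memLp_const 1)).const_mul _
  have hY' : MemLp (fun ω => τ * g ω) 2 μ := h.memLp.const_mul τ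
  have hYlim : Tendsto (fun n => ∫ ω, (Y n ω - τ * g ω) ^ 2 ∂μ) atTop (𝓝 0) := by
    have h1 := hlittle h.remainder
    have h2 : Tendsto (fun n : ℕ => (t n * √(n : ℝ) - τ) ^ 2 * ∫ ω, g ω ^ 2 ∂μ) atTop (𝓝 0) := by
      simpa using ((ht.sub_const τ).pow 2).mul_const (∫ ω, g ω ^ 2 ∂μ)
    have h3 := (h1.const_mul 2).add (h2.const_mul 2)
    rw [mul_zero, add_zero] at h3
    refine squeeze_zero (fun n => integral_nonneg fun _ => sq_nonneg _) (fun n => ?_) h3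
    have h4 := integral_add_sq_le ((memLp_remainder (P := P (t n)) h.memLp (t n)).const_mul √(n : ℝ))
      (h.memLp.const_mul (t n * √(n : ℝ) - τ))
    simp only [mul_pow] at h4
    rw [integral_const_mul, integral_const_mul, Real.sq_sqrt (Nat.cast_nonneg n)] at h4
    refine le_trans (le_of_eq ?_) h4
    congr 1; ext ω
    simp only [hYdef, hs]
    ring
  obtain ⟨C, hC⟩ : ∃ C, ∀ n : ℕ, |a n * √(n : ℝ)| ≤ C := by
    obtain ⟨C, hC⟩ := (Metric.isBounded_range_of_tendsto _ ha).exists_norm_le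
    exact ⟨C, fun n => hC _ (Set.mem_range_self n)⟩
  have hA : Tendsto (fun n : ℕ => (n : ℂ) * ∫ ω, (e n ω - 1) ∂μ) atTop
      (𝓝 (-((A ^ 2 * ∫ ω, f ω ^ 2 ∂μ : ℝ) : ℂ) / 2)) := by
    have h1 : Tendsto (fun n : ℕ => ∫ ω, (n : ℂ) * (e n ω - 1 - (a n * f ω : ℝ) * Complex.I) ∂μ)
        atTop (𝓝 (∫ ω, -((A * f ω : ℝ) : ℂ) ^ 2 / 2 ∂μ)) := by
      refine tendsto_integral_of_dominated_convergence (fun ω => 2 * C ^ 2 * f ω ^ 2)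
        (fun n => by fun_prop) (hf.integrable_sq.const_mul _) (fun n => .of_forall fun ω => ?_)
        (.of_forall fun ω => tendsto_nat_mul_exp_sub (haf ω))
      rw [norm_mul, Complex.norm_natCast]
      have h2 := mul_le_mul_of_nonneg_left (norm_exp_mul_I_sub_one_sub_le (a n * f ω))
        (Nat.cast_nonneg (α := ℝ) n)
      refine h2.trans ?_
      have h3 := pow_le_pow_left₀ (abs_nonneg _) (hC n) 2
      rw [sq_abs, mul_pow, Real.sq_sqrt (Nat.cast_nonneg n)] at h3
      nlinarith [mul_le_mul_of_nonneg_right h3 (sq_nonneg (f ω))]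
    have h2 : ∫ ω, -((A * f ω : ℝ) : ℂ) ^ 2 / 2 ∂μ = -((A ^ 2 * ∫ ω, f ω ^ 2 ∂μ : ℝ) : ℂ) / 2 := by
      have : (fun ω => -((A * f ω : ℝ) : ℂ) ^ 2 / 2) =
          fun ω => ((-(A ^ 2) / 2 * f ω ^ 2 : ℝ) : ℂ) := by
        ext ω; push_cast; ring
      rw [this, integral_complex_ofReal, integral_const_mul]
      push_cast; ring
    rw [h2] at h1
    refine h1.congr fun n => ?_
    have h3 : Integrable (fun ω => e n ω - 1) μ :=
      ((integrable_const (1 : ℝ)).mono' (hem n).aestronglyMeasurable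
        (.of_forall fun ω => (he1 n ω).le)).sub (integrable_const _)
    have h4 : Integrable (fun ω => ((a n * f ω : ℝ) : ℂ) * Complex.I) μ :=
      (((hf.integrable one_le_two).const_mul (a n)).ofReal).mul_const _
    rw [integral_const_mul, integral_sub h3 h4, integral_mul_const, integral_complex_ofReal,
      integral_const_mul, hf0]
    simp
  have hB : Tendsto (fun n : ℕ => ∫ ω, ((√(n : ℝ) : ℂ) * (e n ω - 1)) * (Y n ω : ℂ) ∂μ) atTop
      (𝓝 (((A * τ * ∫ ω, f ω * g ω ∂μ : ℝ) : ℂ) * Complex.I)) := by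
    have h1 := tendsto_integral_mul_of_tendsto_l2 (μ := μ)
      (X := fun n ω => (√(n : ℝ) : ℂ) * (e n ω - 1))
      (X' := fun ω => ((A * f ω : ℝ) : ℂ) * Complex.I) (C := C) hf
      (fun n => by fun_prop) (.of_forall fun n ω => ?_)
      (fun ω => tendsto_sqrt_mul_exp_sub_one (haf ω)) hY hY' hYlim
    · have h2 : ∫ ω, ((A * f ω : ℝ) : ℂ) * Complex.I * ((τ * g ω : ℝ) : ℂ) ∂μ =
          ((A * τ * ∫ ω, f ω * g ω ∂μ : ℝ) : ℂ) * Complex.I := by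
        rw [← integral_const_mul, ← integral_complex_ofReal, ← integral_mul_const]
        congr 1; ext ω; push_cast; ring
      rwa [h2] at h1
    · rw [norm_mul, Complex.norm_real, Real.norm_of_nonneg (Real.sqrt_nonneg _)]
      calc _ ≤ √(n : ℝ) * |a n * f ω| :=
            mul_le_mul_of_nonneg_left (norm_exp_mul_I_sub_one_le _) (Real.sqrt_nonneg _)
        _ = |a n * √(n : ℝ)| * |f ω| := by
            rw [abs_mul, abs_mul, abs_of_nonneg (Real.sqrt_nonneg (n : ℝ))]; ring
        _ ≤ C * |f ω| := mul_le_mul_of_nonneg_right (hC n) (abs_nonneg _)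
  have hD : Tendsto (fun n : ℕ => ∫ ω, (e n ω - 1) * (Y n ω : ℂ) ^ 2 ∂μ) atTop (𝓝 0) := by
    refine tendsto_integral_mul_sq_zero (C := 2) (fun n => by fun_prop) (fun n ω => ?_)
      (fun ω => ?_) hY hY' hYlim
    · refine (norm_sub_le _ _).trans ?_
      rw [he1]; norm_num
    · have h1 := tendsto_zero_of_sqrt_mul (haf ω)
      have h2 : Continuous fun x : ℝ => Complex.exp (x * Complex.I) - 1 := by fun_prop
      have h3 := (h2.tendsto 0).comp h1
      simp only [Complex.ofReal_zero, zero_mul, Complex.exp_zero, sub_self] at h3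
      exact h3
  -- With `s² = 1 + 2 (s - 1) + (s - 1)²` the integrand becomes `n (e - 1) + √n (e - 1) Y + (e - 1)
  -- Y² / 4`. The first term gives the variance, the second the drift, the third vanishes.
  have hE : Tendsto (fun n : ℕ => (n : ℂ) * ∫ ω, (s n ω : ℂ) ^ 2 * (e n ω - 1) ∂μ) atTop
      (𝓝 (((A * τ * ∫ ω, f ω * g ω ∂μ : ℝ) : ℂ) * Complex.I -
        ((A ^ 2 * ∫ ω, f ω ^ 2 ∂μ : ℝ) : ℂ) / 2)) := by
    have h1 := (hA.add hB).add (hD.const_mul (1 / 4))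
    rw [mul_zero, add_zero] at h1
    rw [show ((A * τ * ∫ ω, f ω * g ω ∂μ : ℝ) : ℂ) * Complex.I -
        ((A ^ 2 * ∫ ω, f ω ^ 2 ∂μ : ℝ) : ℂ) / 2 = -((A ^ 2 * ∫ ω, f ω ^ 2 ∂μ : ℝ) : ℂ) / 2 +
        ((A * τ * ∫ ω, f ω * g ω ∂μ : ℝ) : ℂ) * Complex.I by ring]
    refine h1.congr fun n => ?_
    have hem1 : AEStronglyMeasurable (fun ω => e n ω - 1) μ := by fun_prop
    have heb : ∀ᵐ ω ∂μ, ‖e n ω - 1‖ ≤ 2 := .of_forall fun ω => by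
      refine (norm_sub_le _ _).trans ?_
      rw [he1]; norm_num
    have i1 : Integrable (fun ω => (n : ℂ) * (e n ω - 1)) μ :=
      ((integrable_const (2 : ℝ)).mono' hem1 heb).const_mul _
    have i2 : Integrable (fun ω => ((√(n : ℝ) : ℂ) * (e n ω - 1)) * (Y n ω : ℂ)) μ := by
      have := ((((hY n).integrable one_le_two).ofReal (𝕜 := ℂ)).bdd_mul hem1 heb).const_mul
        (√(n : ℝ) : ℂ)
      simp only [mul_assoc]
      exact this
    have i3 : Integrable (fun ω => 1 / 4 * ((e n ω - 1) * (Y n ω : ℂ) ^ 2)) μ := by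
      have := (((hY n).integrable_sq.ofReal (𝕜 := ℂ)).bdd_mul hem1 heb).const_mul (1 / 4 : ℂ)
      simpa using this
    have i12 : Integrable (fun ω => (n : ℂ) * (e n ω - 1) +
      ((√(n : ℝ) : ℂ) * (e n ω - 1)) * (Y n ω : ℂ)) μ := i1.add i2
    rw [← integral_const_mul, ← integral_const_mul, ← integral_const_mul, ← integral_add i1 i2,
      ← integral_add i12 i3]
    congr 1; ext ω
    have h5 : (n : ℂ) = (√(n : ℝ) : ℂ) ^ 2 := by
      rw [← Complex.ofReal_pow, Real.sq_sqrt (Nat.cast_nonneg n)]; simp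
    simp only [hYdef]
    rw [h5]
    push_cast
    ring
  have hF := hlittle h.singular
  have hG : Tendsto (fun n : ℕ => (n : ℂ) * (∫ ω, e n ω ∂(P (t n) : Measure Ω) -
      ∫ ω, (s n ω : ℂ) ^ 2 * e n ω ∂μ)) atTop (𝓝 0) := by
    refine squeeze_zero_norm (fun n => ?_) hF
    rw [norm_mul, Complex.norm_natCast]
    exact mul_le_mul_of_nonneg_left (norm_integral_sub_integral_sqrtDensity_sq_mul_le _ _ (hem n)
      fun ω => (he1 n ω).le) (Nat.cast_nonneg n)
  have hF' : Tendsto (fun n : ℕ => (((n : ℝ) * (1 - ∫ ω, s n ω ^ 2 ∂μ) : ℝ) : ℂ)) atTop (𝓝 0) := by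
    have := (Complex.continuous_ofReal.tendsto _).comp hF
    rwa [Complex.ofReal_zero] at this
  -- Passing from `∫ s² (e - 1)` to `∫ e dP - 1` adds the contribution of the singular part and
  -- subtracts its mass; both are `o(1/n)`.
  have hH := (hE.add hG).sub hF'
  rw [add_zero, sub_zero] at hH
  refine hH.congr fun n => ?_
  have i1 : Integrable (fun ω => (s n ω : ℂ) ^ 2) μ := by
    simpa using (hsL n).integrable_sq.ofReal (𝕜 := ℂ)
  have i2 : Integrable (fun ω => (s n ω : ℂ) ^ 2 * e n ω) μ := by
    have := i1.bdd_mul (hem n).aestronglyMeasurable (.of_forall fun ω => (he1 n ω).le)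
    simpa only [mul_comm] using this
  have h1 : ∫ ω, (s n ω : ℂ) ^ 2 * (e n ω - 1) ∂μ =
      ∫ ω, (s n ω : ℂ) ^ 2 * e n ω ∂μ - ((∫ ω, s n ω ^ 2 ∂μ : ℝ) : ℂ) := by
    rw [← integral_complex_ofReal]
    push_cast
    rw [← integral_sub i2 i1]
    congr 1; ext ω; ring
  change _ = (n : ℂ) * (∫ ω, e n ω ∂(P (t n) : Measure Ω) - 1)
  rw [h1]
  push_cast
  ring

/-! ### The standard normal distribution and the Gauss test. -/

lemma stdNormalCDF_eq_measureReal (x : ℝ) :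
    stdNormalCDF x = (gaussianReal 0 1).real (Set.Iic x) := cdf_eq_real _ x

lemma stdNormalCDF_eq_integral (x : ℝ) :
    stdNormalCDF x = ∫ y in Set.Iic x, gaussianPDFReal 0 1 y := by
  rw [stdNormalCDF_eq_measureReal, Measure.real, gaussianReal_apply_eq_integral 0 one_ne_zero,
    ENNReal.toReal_ofReal (integral_nonneg fun _ => gaussianPDFReal_nonneg _ _ _)]

lemma continuous_gaussianPDFReal (μ : ℝ) (v : NNReal) : Continuous (gaussianPDFReal μ v) := by
  unfold gaussianPDFReal
  fun_prop

lemma hasDerivAt_stdNormalCDF (x : ℝ) : HasDerivAt stdNormalCDF (gaussianPDFReal 0 1 x) x := by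
  have hi := integrable_gaussianPDFReal 0 1
  have h1 : stdNormalCDF =
      fun y => stdNormalCDF 0 + ∫ z in (0 : ℝ)..y, gaussianPDFReal 0 1 z := by
    ext y
    rw [stdNormalCDF_eq_integral, stdNormalCDF_eq_integral,
      ← intervalIntegral.integral_Iic_sub_Iic hi.integrableOn hi.integrableOn]
    ring
  rw [h1]
  exact ((continuous_gaussianPDFReal 0 1).integral_hasStrictDerivAt 0 x).hasDerivAt.const_add _

lemma continuous_stdNormalCDF : Continuous stdNormalCDF :=
  continuous_iff_continuousAt.2 fun x => (hasDerivAt_stdNormalCDF x).continuousAt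

lemma monotone_stdNormalCDF : Monotone stdNormalCDF := monotone_cdf _

lemma measureReal_stdNormal_Ioi (x : ℝ) :
    (gaussianReal 0 1).real (Set.Ioi x) = stdNormalCDF (-x) := by
  have := nullSingletonClass_gaussianReal (μ := 0) (one_ne_zero (α := NNReal))
  have h1 : (gaussianReal 0 1).map (fun y => -y) = gaussianReal 0 1 := by
    rw [gaussianReal_map_neg, neg_zero]
  rw [stdNormalCDF_eq_measureReal, ← measureReal_congr Ioi_ae_eq_Ici.symm]
  conv_lhs => rw [← h1]
  rw [map_measureReal_apply (by fun_prop) measurableSet_Ici]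
  congr 1
  ext y
  simp

lemma measureReal_stdNormal_Iio (x : ℝ) :
    (gaussianReal 0 1).real (Set.Iio x) = stdNormalCDF x := by
  have := nullSingletonClass_gaussianReal (μ := 0) (one_ne_zero (α := NNReal))
  rw [stdNormalCDF_eq_measureReal, measureReal_congr Iio_ae_eq_Iic]

lemma stdNormalCDF_neg (x : ℝ) : stdNormalCDF (-x) = 1 - stdNormalCDF x := by
  rw [← measureReal_stdNormal_Ioi, ← Set.compl_Iic, probReal_compl_eq_one_sub measurableSet_Iic,
    stdNormalCDF_eq_measureReal]

/-- Closedness of the superlevel set puts the infimum in it; points to the left lie outside it, and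
continuity gives the reverse inequality. -/
lemma stdNormalCDF_quantile {p : ℝ} (hp : p ∈ Set.Ioo (0 : ℝ) 1) :
    stdNormalCDF (stdNormalQuantile p) = p := by
  set A := {x : ℝ | p ≤ stdNormalCDF x} with hA
  have hne : A.Nonempty :=
    (((tendsto_cdf_atTop (gaussianReal 0 1)).eventually (lt_mem_nhds hp.2)).exists).imp
      fun x hx => le_of_lt hx
  have hbdd : BddBelow A := by
    obtain ⟨b, hb⟩ := ((tendsto_cdf_atBot (gaussianReal 0 1)).eventually
      (gt_mem_nhds hp.1)).exists
    refine ⟨b, fun x hx => ?_⟩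
    by_contra hlt
    exact absurd (lt_of_le_of_lt (monotone_stdNormalCDF (not_le.1 hlt).le) hb) (not_lt.2 hx)
  have hcl : IsClosed A := isClosed_le continuous_const continuous_stdNormalCDF
  refine le_antisymm ?_ (hcl.csInf_mem hne hbdd)
  refine le_of_tendsto (x := 𝓝[<] (stdNormalQuantile p))
    (continuous_stdNormalCDF.continuousAt.continuousWithinAt) ?_
  filter_upwards [self_mem_nhdsWithin] with x hx
  by_contra hlt
  exact absurd (csInf_le hbdd (show x ∈ A from (not_le.1 hlt).le)) (not_le.2 hx)

lemma stdNormalQuantile_pos {p : ℝ} (hp : p ∈ Set.Ioo (1 / 2 : ℝ) 1) : 0 < stdNormalQuantile p := by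
  have h1 := stdNormalCDF_quantile (p := p) ⟨by linarith [hp.1], hp.2⟩
  have h2 := stdNormalCDF_neg 0
  rw [neg_zero] at h2
  by_contra h
  have h3 := monotone_stdNormalCDF (not_lt.1 h)
  linarith [hp.1]

lemma stdNormalCDF_neg_quantile {α : ℝ} (hα : α ∈ Set.Ioo (0 : ℝ) 1) :
    stdNormalCDF (-stdNormalQuantile (1 - α / 2)) = α / 2 := by
  rw [stdNormalCDF_neg, stdNormalCDF_quantile ⟨by linarith [hα.2], by linarith [hα.1]⟩]
  ring

/-- The power function of the two-sided Gauss test is smallest at `0`. -/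
lemma two_mul_stdNormalCDF_neg_le {u : ℝ} (hu : 0 ≤ u) (a : ℝ) :
    2 * stdNormalCDF (-u) ≤ stdNormalCDF (a - u) + stdNormalCDF (-a - u) := by
  set h : ℝ → ℝ := fun a => stdNormalCDF (a - u) + stdNormalCDF (-a - u) with hh
  have hd (a : ℝ) : HasDerivAt h (gaussianPDFReal 0 1 (a - u) - gaussianPDFReal 0 1 (-a - u)) a := by
    have h1 := (hasDerivAt_stdNormalCDF (a - u)).comp a ((hasDerivAt_id a).sub_const u)
    have h2 := (hasDerivAt_stdNormalCDF (-a - u)).comp a ((hasDerivAt_id a).neg.sub_const u)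
    have h3 := h1.add h2
    rw [mul_one, mul_neg_one, ← sub_eq_add_neg] at h3
    exact h3
  -- The derivative compares the normal density at `a - u` and at `-a - u`; for `a, u ≥ 0` the
  -- former point is closer to `0`. Negative `a` is covered by evenness of `h`.
  have hmono : MonotoneOn h (Set.Ici 0) := by
    refine monotoneOn_of_deriv_nonneg (convex_Ici 0)
      (fun x _ => (hd x).continuousAt.continuousWithinAt)
      (fun x _ => (hd x).differentiableAt.differentiableWithinAt) fun x hx => ?_
    rw [interior_Ici] at hx
    have hx' : 0 < x := hx
    rw [(hd x).deriv, sub_nonneg]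
    simp only [gaussianPDFReal, sub_zero]
    refine mul_le_mul_of_nonneg_left (Real.exp_le_exp.2 ?_) (by positivity)
    simp only [NNReal.coe_one, mul_one]
    nlinarith [mul_nonneg hx'.le hu]
  have key (b : ℝ) (hb : 0 ≤ b) : 2 * stdNormalCDF (-u) ≤ h b := by
    have := hmono (Set.mem_Ici.2 le_rfl) hb hb
    simp only [hh, zero_sub, neg_zero] at this
    linarith
  rcases le_total 0 a with ha | ha
  · exact key a ha
  · have := key (-a) (by linarith)
    simp only [hh, neg_neg] at this
    linarith

lemma gaussianReal_real_lt_abs (m : ℝ) {σ u : ℝ} (hσ : 0 < σ) (hu : 0 ≤ u) :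
    (gaussianReal m (σ ^ 2).toNNReal).real {x | u * σ < |x|} =
      stdNormalCDF (m / σ - u) + stdNormalCDF (-m / σ - u) := by
  have h1 : (gaussianReal 0 1).map (fun x => σ * x + m) = gaussianReal m (σ ^ 2).toNNReal := by
    rw [show (fun x : ℝ => σ * x + m) = (fun x => x + m) ∘ (fun x => σ * x) from rfl,
      ← Measure.map_map (by fun_prop) (by fun_prop), gaussianReal_map_const_mul,
      gaussianReal_map_add_const]
    simp only [mul_zero, zero_add, mul_one]
    congr 1
    ext
    simp [Real.coe_toNNReal _ (sq_nonneg σ)]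
  have hm : MeasurableSet {x : ℝ | u * σ < |x|} :=
    measurableSet_lt measurable_const (by fun_prop)
  rw [← h1, map_measureReal_apply (by fun_prop) hm]
  have h2 : (fun x => σ * x + m) ⁻¹' {x : ℝ | u * σ < |x|} =
      Set.Ioi (u - m / σ) ∪ Set.Iio (-m / σ - u) := by
    obtain ⟨q, rfl⟩ : ∃ q, m = q * σ := ⟨m / σ, by field_simp⟩
    ext x
    simp only [Set.mem_preimage, Set.mem_ofPred_eq, lt_abs, Set.mem_union, Set.mem_Ioi,
      Set.mem_Iio, neg_div, mul_div_cancel_right₀ q hσ.ne']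
    rw [show σ * x + q * σ = (x + q) * σ by ring, ← neg_mul, mul_lt_mul_iff_of_pos_right hσ,
      mul_lt_mul_iff_of_pos_right hσ]
    refine or_congr ?_ ?_ <;> constructor <;> intro _ <;> linarith
  rw [h2, measureReal_union ?_ measurableSet_Iio, measureReal_stdNormal_Ioi,
    measureReal_stdNormal_Iio, neg_sub]
  -- The two tails are disjoint because `u ≥ 0`.
  rw [Set.disjoint_left]
  intro x hx hx'
  simp only [Set.mem_Ioi, Set.mem_Iio, neg_div] at hx hx'
  linarith

/-! ### Central limit theorem for the two samples under local alternatives. -/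

lemma tendsto_one_add_pow_exp {g : ℕ → ℂ} {m : ℕ → ℕ} {z : ℂ} {c : ℝ}
    (hg : Tendsto (fun n : ℕ => (n : ℂ) * g n) atTop (𝓝 z))
    (hm : Tendsto (fun n : ℕ => (m n : ℝ) / n) atTop (𝓝 c)) :
    Tendsto (fun n => (1 + g n) ^ m n) atTop (𝓝 (Complex.exp (c * z))) := by
  have h1 := Complex.tendsto_nat_mul_log_one_add_of_tendsto hg
  have h2 : Tendsto (fun n : ℕ => (((m n : ℝ) / n : ℝ) : ℂ)) atTop (𝓝 (c : ℂ)) :=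
    (Complex.continuous_ofReal.tendsto _).comp hm
  have h3 : Tendsto g atTop (𝓝 0) := by
    have h4 : Tendsto (fun n : ℕ => ((n : ℂ))⁻¹) atTop (𝓝 0) :=
      tendsto_inv_atTop_nhds_zero_nat (𝕜 := ℂ)
    have h5 := h4.mul hg
    rw [zero_mul] at h5
    refine h5.congr' ?_
    filter_upwards [eventually_gt_atTop 0] with n hn
    have : (n : ℂ) ≠ 0 := Nat.cast_ne_zero.2 hn.ne'
    field_simp
  have h6 := (Complex.continuous_exp.tendsto _).comp (h2.mul h1)
  refine h6.congr' ?_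
  have h7 : ∀ᶠ n in atTop, ‖g n‖ < 1 := by
    have := h3.norm
    rw [norm_zero] at this
    exact this.eventually (gt_mem_nhds one_pos)
  filter_upwards [eventually_gt_atTop 0, h7] with n hn hgn
  have hn' : (n : ℂ) ≠ 0 := Nat.cast_ne_zero.2 hn.ne'
  have hne : 1 + g n ≠ 0 := fun h0 => by
    have : g n = -1 := by linear_combination h0
    rw [this] at hgn
    simp at hgn
  simp only [Function.comp_apply]
  rw [← Complex.exp_log hne, ← Complex.exp_nat_mul, Complex.exp_log hne]
  congr 1
  push_cast
  field_simp

instance isProbabilityMeasure_sampleLaw (P : ProbabilityMeasure Ω₁) (Q : ProbabilityMeasure Ω₂)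
    (m₁ m₂ : ℕ) : IsProbabilityMeasure (sampleLaw P Q m₁ m₂) := by
  unfold sampleLaw; infer_instance

lemma charFun_map_sampleLaw (P : ProbabilityMeasure Ω₁) (Q : ProbabilityMeasure Ω₂) (m₁ m₂ : ℕ)
    {f₁ : Ω₁ → ℝ} {f₂ : Ω₂ → ℝ} (hf₁ : Measurable f₁) (hf₂ : Measurable f₂) (c₁ c₂ u : ℝ) :
    charFun ((sampleLaw P Q m₁ m₂).map fun ω => c₁ * ∑ i, f₁ (ω.1 i) + c₂ * ∑ j, f₂ (ω.2 j)) u =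
      (∫ x, Complex.exp ((u * c₁ * f₁ x : ℝ) * Complex.I) ∂(P : Measure Ω₁)) ^ m₁ *
      (∫ y, Complex.exp ((u * c₂ * f₂ y : ℝ) * Complex.I) ∂(Q : Measure Ω₂)) ^ m₂ := by
  have hm : Measurable fun ω : (Fin m₁ → Ω₁) × (Fin m₂ → Ω₂) =>
      c₁ * ∑ i, f₁ (ω.1 i) + c₂ * ∑ j, f₂ (ω.2 j) := by fun_prop
  rw [charFun_apply_real, integral_map hm.aemeasurable (by fun_prop)]
  have h1 (ω : (Fin m₁ → Ω₁) × (Fin m₂ → Ω₂)) :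
      Complex.exp (u * (c₁ * ∑ i, f₁ (ω.1 i) + c₂ * ∑ j, f₂ (ω.2 j) : ℝ) * Complex.I) =
      (∏ i, Complex.exp ((u * c₁ * f₁ (ω.1 i) : ℝ) * Complex.I)) *
        ∏ j, Complex.exp ((u * c₂ * f₂ (ω.2 j) : ℝ) * Complex.I) := by
    rw [← Complex.exp_sum, ← Complex.exp_sum, ← Complex.exp_add, ← Finset.sum_mul,
      ← Finset.sum_mul, ← add_mul]
    push_cast
    rw [← Finset.mul_sum, ← Finset.mul_sum]
    ring_nf
  simp only [h1]
  rw [sampleLaw, integral_prod_mul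
    (fun x : Fin m₁ → Ω₁ => ∏ i, Complex.exp ((u * c₁ * f₁ (x i) : ℝ) * Complex.I))
    (fun y : Fin m₂ → Ω₂ => ∏ j, Complex.exp ((u * c₂ * f₂ (y j) : ℝ) * Complex.I)),
    integral_fintype_prod_eq_prod (fun _ x => Complex.exp ((u * c₁ * f₁ x : ℝ) * Complex.I)),
    integral_fintype_prod_eq_prod (fun _ x => Complex.exp ((u * c₂ * f₂ x : ℝ) * Complex.I))]
  simp

/-- Asymptotic normality of two-sample linear statistics under local alternatives. -/
lemma tendsto_charFun_sampleLaw {P : ℝ → ProbabilityMeasure Ω₁} {Q : ℝ → ProbabilityMeasure Ω₂}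
    {g₁ f₁ : Ω₁ → ℝ} {g₂ f₂ : Ω₂ → ℝ} (hP : HasL2Tangent P g₁) (hQ : HasL2Tangent Q g₂)
    (hf₁m : Measurable f₁) (hf₂m : Measurable f₂)
    (hf₁ : MemLp f₁ 2 (P 0 : Measure Ω₁)) (hf₂ : MemLp f₂ 2 (Q 0 : Measure Ω₂))
    (hf₁0 : ∫ x, f₁ x ∂(P 0 : Measure Ω₁) = 0) (hf₂0 : ∫ y, f₂ y ∂(Q 0 : Measure Ω₂) = 0)
    {t : ℕ → ℝ} {τ : ℝ} (hτ : 0 < τ) (ht : Tendsto (fun n : ℕ => t n * √(n : ℝ)) atTop (𝓝 τ))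
    {n₁ n₂ : ℕ → ℕ} {d₁ d₂ : ℝ} (hd₁ : 0 < d₁) (hd₂ : 0 < d₂)
    (hn₁ : Tendsto (fun n : ℕ => (n₁ n : ℝ) / n) atTop (𝓝 d₁))
    (hn₂ : Tendsto (fun n : ℕ => (n₂ n : ℝ) / n) atTop (𝓝 d₂)) (u : ℝ) :
    Tendsto (fun n : ℕ => charFun ((sampleLaw (P (t n)) (Q (t n)) (n₁ n) (n₂ n)).map fun ω =>
      √(n : ℝ) / n₁ n * ∑ i, f₁ (ω.1 i) + √(n : ℝ) / n₂ n * ∑ j, f₂ (ω.2 j)) u) atTop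
      (𝓝 (charFun (gaussianReal
        (τ * (∫ x, f₁ x * g₁ x ∂(P 0 : Measure Ω₁) + ∫ y, f₂ y * g₂ y ∂(Q 0 : Measure Ω₂)))
        (1 / d₁ * ∫ x, f₁ x ^ 2 ∂(P 0 : Measure Ω₁) +
          1 / d₂ * ∫ y, f₂ y ^ 2 ∂(Q 0 : Measure Ω₂)).toNNReal) u)) := by
  -- The coefficient `u √n / m` corresponds to `A = u / c`. After multiplication by `c` in the
  -- exponent, the drift loses its `c` and the variance keeps `1 / c`.
  have hscale {m : ℕ → ℕ} {c : ℝ} (hc : 0 < c)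
      (hm : Tendsto (fun n : ℕ => (m n : ℝ) / n) atTop (𝓝 c)) :
      Tendsto (fun n : ℕ => u * (√(n : ℝ) / m n) * √(n : ℝ)) atTop (𝓝 (u * c⁻¹)) := by
    refine ((hm.inv₀ hc.ne').const_mul u).congr fun n => ?_
    rw [inv_div]
    nth_rw 1 [← Real.mul_self_sqrt (Nat.cast_nonneg (α := ℝ) n)]
    ring
  have h1 := tendsto_one_add_pow_exp (hP.tendsto_nat_mul_integral_exp_sub_one hf₁m hf₁ hf₁0 hτ ht
    (hscale hd₁ hn₁)) hn₁
  have h2 := tendsto_one_add_pow_exp (hQ.tendsto_nat_mul_integral_exp_sub_one hf₂m hf₂ hf₂0 hτ ht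
    (hscale hd₂ hn₂)) hn₂
  have h3 := h1.mul h2
  have hv : 0 ≤ 1 / d₁ * ∫ x, f₁ x ^ 2 ∂(P 0 : Measure Ω₁) +
      1 / d₂ * ∫ y, f₂ y ^ 2 ∂(Q 0 : Measure Ω₂) :=
    add_nonneg (mul_nonneg (by positivity) (integral_nonneg fun _ => sq_nonneg _))
      (mul_nonneg (by positivity) (integral_nonneg fun _ => sq_nonneg _))
  rw [charFun_gaussianReal, Real.coe_toNNReal _ hv]
  rw [← Complex.exp_add] at h3
  convert h3 using 2 with n
  · rw [charFun_map_sampleLaw _ _ _ _ hf₁m hf₂m]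
    simp
  · congr 1
    have hd₁' : (d₁ : ℂ) ≠ 0 := Complex.ofReal_ne_zero.2 hd₁.ne'
    have hd₂' : (d₂ : ℂ) ≠ 0 := Complex.ofReal_ne_zero.2 hd₂.ne'
    push_cast
    field_simp
    ring

/-- Lévy's theorem gives weak convergence; the boundary of the rejection region lies in `{c, -c}`,
which is null for a nondegenerate Gaussian. -/
lemma tendsto_measureReal_lt_abs {μ : ℕ → Measure ℝ} [∀ n, IsProbabilityMeasure (μ n)] {m : ℝ}
    {v : NNReal} (hv : v ≠ 0)
    (h : ∀ u, Tendsto (fun n => charFun (μ n) u) atTop (𝓝 (charFun (gaussianReal m v) u))) (c : ℝ) :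
    Tendsto (fun n => (μ n).real {x | c < |x|}) atTop
      (𝓝 ((gaussianReal m v).real {x | c < |x|})) := by
  have := nullSingletonClass_gaussianReal (μ := m) hv
  let ν : ℕ → ProbabilityMeasure ℝ := fun n => ⟨μ n, inferInstance⟩
  let ν₀ : ProbabilityMeasure ℝ := ⟨gaussianReal m v, inferInstance⟩
  have h1 : Tendsto ν atTop (𝓝 ν₀) := ProbabilityMeasure.tendsto_iff_tendsto_charFun.2 h
  have h2 : gaussianReal m v (frontier {x : ℝ | c < |x|}) = 0 := by
    refine measure_mono_null (t := {c, -c}) ?_ ((Set.toFinite _).measure_zero _)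
    refine (frontier_lt_subset_eq continuous_const continuous_abs).trans fun x hx => ?_
    have hx' : c = |x| := hx
    rcases abs_choice x with h3 | h3 <;> simp [hx', h3]
  have h3 := ProbabilityMeasure.tendsto_measure_of_null_frontier_of_tendsto' (μ := ν₀) h1 h2
  exact (ENNReal.tendsto_toReal (measure_ne_top _ _)).comp h3

/-! ### Components of the gradient and positivity of the variance. -/

section Components

variable {P₀ : ProbabilityMeasure Ω₁} {Q₀ : ProbabilityMeasure Ω₂} {κ : Ω₁ × Ω₂ → ℝ}

lemma measurable_component₁ (hκ : Measurable κ) : Measurable (component₁ Q₀ κ) :=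
  hκ.stronglyMeasurable.integral_prod_right'.measurable

lemma measurable_component₂ (hκ : Measurable κ) : Measurable (component₂ P₀ κ) :=
  hκ.stronglyMeasurable.integral_prod_left'.measurable

lemma memLp_component₁ (hκ : MemLp κ 2 ((P₀ : Measure Ω₁).prod (Q₀ : Measure Ω₂))) :
    MemLp (component₁ Q₀ κ) 2 (P₀ : Measure Ω₁) := memLp_integral_right hκ

lemma memLp_component₂ (hκ : MemLp κ 2 ((P₀ : Measure Ω₁).prod (Q₀ : Measure Ω₂))) :
    MemLp (component₂ P₀ κ) 2 (Q₀ : Measure Ω₂) := memLp_integral_left hκ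

lemma integral_component₁ (hκ : MemLp κ 2 ((P₀ : Measure Ω₁).prod (Q₀ : Measure Ω₂))) :
    ∫ x, component₁ Q₀ κ x ∂(P₀ : Measure Ω₁) =
      ∫ z, κ z ∂(P₀ : Measure Ω₁).prod (Q₀ : Measure Ω₂) :=
  (integral_prod _ (hκ.integrable one_le_two)).symm

lemma integral_component₂ (hκ : MemLp κ 2 ((P₀ : Measure Ω₁).prod (Q₀ : Measure Ω₂))) :
    ∫ y, component₂ P₀ κ y ∂(Q₀ : Measure Ω₂) =
      ∫ z, κ z ∂(P₀ : Measure Ω₁).prod (Q₀ : Measure Ω₂) :=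
  (integral_prod_symm _ (hκ.integrable one_le_two)).symm

lemma integral_mul_eq_components (hκ : MemLp κ 2 ((P₀ : Measure Ω₁).prod (Q₀ : Measure Ω₂)))
    {g : Ω₁ × Ω₂ → ℝ} {g₁ : Ω₁ → ℝ} {g₂ : Ω₂ → ℝ} (hg₁ : MemLp g₁ 2 (P₀ : Measure Ω₁))
    (hg₂ : MemLp g₂ 2 (Q₀ : Measure Ω₂))
    (hg : g =ᵐ[(P₀ : Measure Ω₁).prod (Q₀ : Measure Ω₂)] fun z => g₁ z.1 + g₂ z.2) :
    ∫ z, κ z * g z ∂(P₀ : Measure Ω₁).prod (Q₀ : Measure Ω₂) =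
      ∫ x, component₁ Q₀ κ x * g₁ x ∂(P₀ : Measure Ω₁) +
        ∫ y, component₂ P₀ κ y * g₂ y ∂(Q₀ : Measure Ω₂) := by
  have i1 : Integrable (fun z : Ω₁ × Ω₂ => κ z * g₁ z.1)
      ((P₀ : Measure Ω₁).prod (Q₀ : Measure Ω₂)) := hκ.integrable_mul (memLp_fst hg₁)
  have i2 : Integrable (fun z : Ω₁ × Ω₂ => κ z * g₂ z.2)
      ((P₀ : Measure Ω₁).prod (Q₀ : Measure Ω₂)) := hκ.integrable_mul (memLp_snd hg₂)
  calc _ = ∫ z : Ω₁ × Ω₂, (κ z * g₁ z.1 + κ z * g₂ z.2)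
        ∂(P₀ : Measure Ω₁).prod (Q₀ : Measure Ω₂) := by
        refine integral_congr_ae ?_
        filter_upwards [hg] with z hz
        rw [hz, mul_add]
    _ = _ := by
        rw [integral_add i1 i2, integral_prod _ i1, integral_prod_symm _ i2]
        simp only [integral_mul_const, component₁, component₂]

/-- The tangents of curves of product measures are sums of tangents of the factors. -/
lemma HasL2Tangent.integral_mul_eq {P : ℝ → ProbabilityMeasure Ω₁} {Q : ℝ → ProbabilityMeasure Ω₂}
    {g : Ω₁ × Ω₂ → ℝ} (h : HasL2Tangent (fun t => (P t).prod (Q t)) g)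
    (hκ : MemLp κ 2 ((P 0 : Measure Ω₁).prod (Q 0 : Measure Ω₂))) :
    ∫ z, κ z * g z ∂(P 0 : Measure Ω₁).prod (Q 0 : Measure Ω₂) =
      ∫ x, component₁ (Q 0) κ x * (∫ y, g (x, y) ∂(Q 0 : Measure Ω₂)) ∂(P 0 : Measure Ω₁) +
        ∫ y, component₂ (P 0) κ y * (∫ x, g (x, y) ∂(P 0 : Measure Ω₁)) ∂(Q 0 : Measure Ω₂) :=
  integral_mul_eq_components hκ h.fst.memLp h.snd.memLp h.ae_eq_add

lemma integral_mul_eq_zero_of_mem_tangentCone {Pfam : Set (ProbabilityMeasure Ω₁)}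
    {Qfam : Set (ProbabilityMeasure Ω₂)}
    (hκ : MemLp κ 2 ((P₀ : Measure Ω₁).prod (Q₀ : Measure Ω₂)))
    (h1 : component₁ Q₀ κ =ᵐ[(P₀ : Measure Ω₁)] 0) (h2 : component₂ P₀ κ =ᵐ[(Q₀ : Measure Ω₂)] 0)
    {g : Lp ℝ 2 (P₀.prod Q₀ : Measure (Ω₁ × Ω₂))}
    (hg : g ∈ tangentCone (prodFamily Pfam Qfam) (P₀.prod Q₀)) :
    ∫ z, κ z * g z ∂(P₀ : Measure Ω₁).prod (Q₀ : Measure Ω₂) = 0 := by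
  obtain ⟨-, ε, c, hc0, hc⟩ := hg
  -- The factors are chosen pointwise. They are fixed as `(P₀, Q₀)` at `t = 0`, to match the
  -- components of `κ`, and set to the same default where the curve need not lie in the family.
  have hex : ∀ t : ℝ, ∃ p : ProbabilityMeasure Ω₁ × ProbabilityMeasure Ω₂,
      (|t| < ε → c t = p.1.prod p.2) ∧ (t = 0 → p = (P₀, Q₀)) := by
    intro t
    by_cases ht : t = 0
    · exact ⟨(P₀, Q₀), fun _ => by rw [ht, hc0], fun _ => rfl⟩
    · by_cases hε : |t| < ε
      · obtain ⟨P, -, Q, -, hPQ⟩ := hc.mem t hε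
        exact ⟨(P, Q), fun _ => hPQ, fun h => absurd h ht⟩
      · exact ⟨(P₀, Q₀), fun h => absurd h hε, fun h => absurd h ht⟩
  choose p hp hp0 using hex
  obtain rfl : P₀ = (p 0).1 := by rw [hp0 0 rfl]
  obtain rfl : Q₀ = (p 0).2 := by rw [hp0 0 rfl]
  have h : HasL2Tangent (fun t => (p t).1.prod (p t).2) g := by
    refine hc.hasL2Tangent.congr hc0 ?_
    refine eventually_nhdsWithin_of_eventually_nhds ?_
    filter_upwards [Metric.ball_mem_nhds (0 : ℝ) hc.pos] with t ht
    exact hp t (by simpa using ht)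
  rw [h.integral_mul_eq (P := fun t => (p t).1) (Q := fun t => (p t).2) hκ]
  have e1 : ∫ x, component₁ (p 0).2 κ x * (∫ y, g (x, y) ∂((p 0).2 : Measure Ω₂))
      ∂((p 0).1 : Measure Ω₁) = 0 :=
    integral_eq_zero_of_ae (by filter_upwards [h1] with x hx; simp [hx])
  have e2 : ∫ y, component₂ (p 0).1 κ y * (∫ x, g (x, y) ∂((p 0).1 : Measure Ω₁))
      ∂((p 0).2 : Measure Ω₂) = 0 :=
    integral_eq_zero_of_ae (by filter_upwards [h2] with x hx; simp [hx])
  rw [e1, e2, add_zero]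

/-- If the variance vanished, both components of `κ` would be null and `κ` would be orthogonal to
every tangent. Lying in the tangent space, it would be orthogonal to itself. -/
lemma sigma₁_pos {Pfam : Set (ProbabilityMeasure Ω₁)} {Qfam : Set (ProbabilityMeasure Ω₂)}
    {k : ProbabilityMeasure (Ω₁ × Ω₂) → ℝ}
    (hκ : IsCanonicalGradient (prodFamily Pfam Qfam) k (P₀.prod Q₀) κ)
    (hκ0 : ∫ ω, κ ω ^ 2 ∂(P₀.prod Q₀ : Measure (Ω₁ × Ω₂)) ≠ 0) {d : ℝ}
    (hd : d ∈ Set.Ioo (0 : ℝ) 1) : 0 < sigma₁ P₀ Q₀ κ d := by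
  have hL : MemLp κ 2 (P₀.prod Q₀ : Measure (Ω₁ × Ω₂)) := hκ.isGradient.memLp
  have hd' : 0 < 1 - d := by linarith [hd.2]
  have hd0 : 0 < d := hd.1
  have n1 : 0 ≤ ∫ x, component₁ Q₀ κ x ^ 2 ∂(P₀ : Measure Ω₁) := integral_nonneg fun _ => sq_nonneg _
  have n2 : 0 ≤ ∫ y, component₂ P₀ κ y ^ 2 ∂(Q₀ : Measure Ω₂) := integral_nonneg fun _ => sq_nonneg _
  refine Real.sqrt_pos.2 (lt_of_le_of_ne (by positivity) fun h0 => hκ0 ?_)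
  have z1 : ∫ x, component₁ Q₀ κ x ^ 2 ∂(P₀ : Measure Ω₁) = 0 := by
    by_contra hne
    have := lt_of_le_of_ne n1 (Ne.symm hne)
    have : 0 < 1 / (1 - d) * ∫ x, component₁ Q₀ κ x ^ 2 ∂(P₀ : Measure Ω₁) := by positivity
    have : 0 ≤ 1 / d * ∫ y, component₂ P₀ κ y ^ 2 ∂(Q₀ : Measure Ω₂) := by positivity
    linarith
  have z2 : ∫ y, component₂ P₀ κ y ^ 2 ∂(Q₀ : Measure Ω₂) = 0 := by
    rw [z1, mul_zero, zero_add] at h0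
    exact (mul_eq_zero.1 h0.symm).resolve_left (by positivity)
  rw [integral_eq_zero_iff_of_nonneg (fun _ => sq_nonneg _)
    (memLp_component₁ hL).integrable_sq] at z1
  rw [integral_eq_zero_iff_of_nonneg (fun _ => sq_nonneg _)
    (memLp_component₂ hL).integrable_sq] at z2
  have h1 : component₁ Q₀ κ =ᵐ[(P₀ : Measure Ω₁)] 0 := by
    filter_upwards [z1] with x hx; simpa using hx
  have h2 : component₂ P₀ κ =ᵐ[(Q₀ : Measure Ω₂)] 0 := by
    filter_upwards [z2] with x hx; simpa using hx
  set K := hκ.isGradient.memLp.toLp κ with hK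
  have hinner (g : Lp ℝ 2 (P₀.prod Q₀ : Measure (Ω₁ × Ω₂))) :
      inner ℝ K g = ∫ z, κ z * g z ∂(P₀.prod Q₀ : Measure (Ω₁ × Ω₂)) := by
    rw [L2.inner_def]
    refine integral_congr_ae ?_
    filter_upwards [hκ.isGradient.memLp.coeFn_toLp] with z hz
    rw [hz]
    simp [mul_comm]
  -- The orthogonal complement of `K` is a closed subspace, so checking it on the tangent cone
  -- suffices.
  have hsub : tangentSpace (prodFamily Pfam Qfam) (P₀.prod Q₀) ≤ (ℝ ∙ K)ᗮ := by
    refine Submodule.topologicalClosure_minimal _ (Submodule.span_le.2 fun g hg => ?_)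
      (Submodule.isClosed_orthogonal _)
    rw [SetLike.mem_coe, Submodule.mem_orthogonal_singleton_iff_inner_right, hinner]
    exact integral_mul_eq_zero_of_mem_tangentCone hL h1 h2 hg
  have h3 := hsub hκ.mem_tangentSpace
  rw [Submodule.mem_orthogonal_singleton_iff_inner_right, hinner] at h3
  rw [← h3]
  refine integral_congr_ae ?_
  filter_upwards [hκ.isGradient.memLp.coeFn_toLp] with z hz
  rw [hz, sq]

lemma power_twoSidedTest (hκ : Measurable κ) {n₁ n₂ : ℕ → ℕ} (d α : ℝ)
    (S : ℕ → ProbabilityMeasure Ω₁ × ProbabilityMeasure Ω₂) (n : ℕ) :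
    power n₁ n₂ (fun n => twoSidedTest P₀ Q₀ κ d α (n₁ n) (n₂ n)) S n =
      ((sampleLaw (S n).1 (S n).2 (n₁ n) (n₂ n)).map
        (testStatistic P₀ Q₀ κ (n₁ n) (n₂ n))).real
        {x | stdNormalQuantile (1 - α / 2) * sigma₁ P₀ Q₀ κ d < |x|} := by
  have hm₁ : Measurable (component₁ Q₀ κ) := measurable_component₁ hκ
  have hm₂ : Measurable (component₂ P₀ κ) := measurable_component₂ hκ
  have hT : Measurable (testStatistic P₀ Q₀ κ (n₁ n) (n₂ n)) := by
    unfold testStatistic; fun_prop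
  have hA : MeasurableSet {x : ℝ | stdNormalQuantile (1 - α / 2) * sigma₁ P₀ Q₀ κ d < |x|} :=
    measurableSet_lt measurable_const (by fun_prop)
  rw [map_measureReal_apply hT hA, power, twoSidedTest]
  exact integral_indicator_one (hT hA)

end Components

end TwoSample

/-! ### Limiting power and asymptotic unbiasedness. -/

open TwoSample

theorem mainTheorem5 {Ω₁ Ω₂ : Type*} [MeasurableSpace Ω₁] [MeasurableSpace Ω₂]
    (Pfam : Set (ProbabilityMeasure Ω₁)) (Qfam : Set (ProbabilityMeasure Ω₂))
    (k : ProbabilityMeasure (Ω₁ × Ω₂) → ℝ)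
    (P₀ : ProbabilityMeasure Ω₁) (hP₀ : P₀ ∈ Pfam) (Q₀ : ProbabilityMeasure Ω₂) (hQ₀ : Q₀ ∈ Qfam)
    (κ : Ω₁ × Ω₂ → ℝ) (hκm : Measurable κ)
    (hκ : IsCanonicalGradient (prodFamily Pfam Qfam) k (P₀.prod Q₀) κ)
    (hκ0 : ∫ ω, κ ω ^ 2 ∂(P₀.prod Q₀ : Measure (Ω₁ × Ω₂)) ≠ 0)
    (α : ℝ) (hα : α ∈ Set.Ioo (0 : ℝ) 1)
    (n₁ n₂ : ℕ → ℕ) (hn : ∀ n, n₁ n + n₂ n = n)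
    (d : ℝ) (hd : d ∈ Set.Ioo (0 : ℝ) 1)
    (hnd : Tendsto (fun n => (n₂ n : ℝ) / n) atTop (𝓝 d)) :
    (∀ S ∈ localSequences Pfam Qfam P₀ Q₀, ∃ ϑ : ℝ,
      Tendsto (localValue k P₀ Q₀ S) atTop (𝓝 ϑ) ∧
      Tendsto (power n₁ n₂ (fun n => twoSidedTest P₀ Q₀ κ d α (n₁ n) (n₂ n)) S) atTop
        (𝓝 (stdNormalCDF (ϑ / sigma₁ P₀ Q₀ κ d - stdNormalQuantile (1 - α / 2)) +
          stdNormalCDF (-ϑ / sigma₁ P₀ Q₀ κ d - stdNormalQuantile (1 - α / 2))))) ∧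
    IsAsymptoticallyUnbiased α n₁ n₂ (fun n => twoSidedTest P₀ Q₀ κ d α (n₁ n) (n₂ n))
      (implicitHypotheses Pfam Qfam k P₀ Q₀) (implicitAlternatives Pfam Qfam k P₀ Q₀) := by

  have hL : MemLp κ 2 ((P₀ : Measure Ω₁).prod (Q₀ : Measure Ω₂)) := hκ.isGradient.memLp
  have hmean : ∫ z, κ z ∂(P₀ : Measure Ω₁).prod (Q₀ : Measure Ω₂) = 0 :=
    hκ.isGradient.integral_eq_zero
  have hσ : 0 < sigma₁ P₀ Q₀ κ d := sigma₁_pos hκ hκ0 hd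
  set σ := sigma₁ P₀ Q₀ κ d with hσdef
  have hu : 0 < stdNormalQuantile (1 - α / 2) :=
    stdNormalQuantile_pos ⟨by linarith [hα.2], by linarith [hα.1]⟩
  have hd' : 0 < 1 - d := by linarith [hd.2]
  have hn₁ : Tendsto (fun n : ℕ => (n₁ n : ℝ) / n) atTop (𝓝 (1 - d)) := by
    refine (hnd.const_sub 1).congr' ?_
    filter_upwards [eventually_gt_atTop 0] with n hn0
    have h1 : (n₁ n : ℝ) + n₂ n = n := by exact_mod_cast hn n
    have h2 : (n : ℝ) ≠ 0 := Nat.cast_ne_zero.2 hn0.ne'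
    field_simp
    linarith
  have main : ∀ S ∈ localSequences Pfam Qfam P₀ Q₀, ∃ ϑ : ℝ,
      Tendsto (localValue k P₀ Q₀ S) atTop (𝓝 ϑ) ∧
      Tendsto (power n₁ n₂ (fun n => twoSidedTest P₀ Q₀ κ d α (n₁ n) (n₂ n)) S) atTop
        (𝓝 (stdNormalCDF (ϑ / σ - stdNormalQuantile (1 - α / 2)) +
          stdNormalCDF (-ϑ / σ - stdNormalQuantile (1 - α / 2)))) := by
    rintro S ⟨t, τ, ε, P, Q, g, ht0, hτ, hτpos, rfl, rfl, hc, hS⟩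
    have hT : HasL2Tangent (fun s => (P s).prod (Q s)) g := hc.hasL2Tangent
    refine ⟨τ * ∫ z, κ z * g z ∂(P 0 : Measure Ω₁).prod (Q 0 : Measure Ω₂), ?_, ?_⟩
    -- The derivative of `k` is a limit from the right, so `t n > 0` is needed; then `√n Δk = (t n
    -- √n) (Δk / t n)`, where `Δk` is the increment of `k` along the curve.
    · have hpos : ∀ᶠ n in atTop, 0 < t n := by
        filter_upwards [hτ.eventually (lt_mem_nhds hτpos)] with n hn
        exact pos_of_mul_pos_left hn (Real.sqrt_nonneg _)
      have h1 := (hκ.isGradient.tendsto ε _ g hc rfl).comp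
        (tendsto_nhdsWithin_iff.2 ⟨ht0, hpos⟩)
      refine (hτ.mul h1).congr' ?_
      filter_upwards [hpos] with n hn
      simp only [Function.comp_apply, localValue, (hS n).2]
      field_simp
    · have hlim := tendsto_charFun_sampleLaw hT.fst hT.snd (measurable_component₁ hκm)
        (measurable_component₂ hκm) (memLp_component₁ hL) (memLp_component₂ hL)
        ((integral_component₁ hL).trans hmean) ((integral_component₂ hL).trans hmean) hτpos hτ
        hd' hd.1 hn₁ hnd
      -- This identifies the drift of the statistic with the limit `ϑ` of the functional.
      rw [← hT.integral_mul_eq hL] at hlim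
      set v : ℝ := 1 / (1 - d) * ∫ x, component₁ (Q 0) κ x ^ 2 ∂(P 0 : Measure Ω₁) +
        1 / d * ∫ y, component₂ (P 0) κ y ^ 2 ∂(Q 0 : Measure Ω₂) with hv
      have hσv : σ = √v := rfl
      have hv0 : 0 < v := Real.sqrt_pos.1 (hσv ▸ hσ)
      have hσ2 : σ ^ 2 = v := by rw [hσv, Real.sq_sqrt hv0.le]
      have hm₁ : Measurable (component₁ (Q 0) κ) := measurable_component₁ hκm
      have hm₂ : Measurable (component₂ (P 0) κ) := measurable_component₂ hκm
      have hprob (n : ℕ) : IsProbabilityMeasure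
          ((sampleLaw (P (t n)) (Q (t n)) (n₁ n) (n₂ n)).map fun ω =>
            √(n : ℝ) / n₁ n * ∑ i, component₁ (Q 0) κ (ω.1 i) +
              √(n : ℝ) / n₂ n * ∑ j, component₂ (P 0) κ (ω.2 j)) :=
        Measure.isProbabilityMeasure_map (by fun_prop)
      have h2 := tendsto_measureReal_lt_abs (Real.toNNReal_pos.2 hv0).ne' hlim
        (stdNormalQuantile (1 - α / 2) * σ)
      rw [← hσ2, gaussianReal_real_lt_abs _ hσ hu.le] at h2
      refine h2.congr fun n => ?_
      rw [power_twoSidedTest hκm, (hS n).2]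
      unfold testStatistic
      rw [hn n]
  refine ⟨main, fun S hS => ?_, fun S hS => ?_⟩
  · obtain ⟨ϑ, h1, h2⟩ := main S hS.1
    obtain rfl := tendsto_nhds_unique h1 hS.2
    rw [h2.limsup_eq]
    simp only [neg_zero, zero_div, zero_sub, stdNormalCDF_neg_quantile hα]
    linarith
  · obtain ⟨ϑ, -, h2⟩ := main S hS.1
    rw [h2.liminf_eq]
    -- The minimum of the limiting power is `2 Φ(-u) = 2 (α / 2) = α`.
    have h3 := two_mul_stdNormalCDF_neg_le hu.le (ϑ / σ)
    rw [stdNormalCDF_neg_quantile hα] at h3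
    rw [neg_div]
    linarith
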